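/- Let $n\ge 2$ and let $c,a>0$ and $A,L,K_0\in\mathbb{R}$. There is a constant $C>0$, depending only on $n,c,a,A,L,K_0$, with the following property. Let $f,g:\mathbb{S}^{n-1}\to\mathbb{R}$ be smooth functions with $a\le f\le A$, $a\le g\le A$ and $|\nabla g|\le L$ on $\mathbb{S}^{n-1}$. Let $0<T\le\infty$ and let $X:\mathbb{S}^{n-1}\times[0,T)\to\mathbb{R}^n$ be a smooth map such that, for every $t\in[0,T)$, $X(\cdot,t)$ is a smooth embedding onto a closed, strictly convex hypersurface $M_t$ (the boundary of a convex body, with positive definite second fundamental form) that encloses the origin in its interior, and such that $$\frac{\partial X}{\partial t}(x,t)=-\frac{f(\nu)}{g\big(X/|X|\big)}\,|X|^n\,\mathcal{K}\,\nu+X\qquad\text{on }\mathbb{S}^{n-1}\times[0,T),$$ where $\nu$ is the outer unit normal and $\mathcal{K}=\mathcal{K}(x,t)$ the Gauss curvature of $M_t$ at $X(x,t)$. Let $h(x,t)=\max_{y\in M_t}\langle y,x\rangle$ be the support function of $M_t$. If the Gauss curvature of the initial hypersurface $M_0$ is at most $K_0$ and $$\frac1c\le h(x,t)\le c\qquad\text{for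 all }(x,t)\in\mathbb{S}^{n-1}\times[0,T),$$ then $$\mathcal{K}(x,t)\le C\qquad\text{for all }(x,t)\in\mathbb{S}^{n-1}\times[0,T).$$ -/

import Mathlib

open Set Metric
open scoped Manifold ContDiff RealInnerProductSpace

/-- Euclidean space `ℝⁿ` with `n = m + 1`. -/
abbrev Euc (m : ℕ) : Type := EuclideanSpace ℝ (Fin (m + 1))

/-- The unit sphere `𝕊ⁿ⁻¹ ⊆ ℝⁿ`, `n = m + 1`; a smooth manifold of dimension `m = n - 1`. -/
abbrev Sph (m : ℕ) : Type := sphere (0 : Euc m) 1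

instance factFinrankEuc (m : ℕ) : Fact (Module.finrank ℝ (Euc m) = m + 1) :=
  ⟨by simp⟩

/-- The direction `y / |y| ∈ 𝕊ⁿ⁻¹` of a nonzero vector `y` (an arbitrary fixed point of the sphere
for `y = 0`, which never occurs on a hypersurface that encloses the origin). -/
noncomputable def direction {m : ℕ} (y : Euc m) : Sph m :=
  if h : y = 0 then ⟨EuclideanSpace.single 0 1, by simp⟩
  else ⟨‖y‖⁻¹ • y, by
    rw [mem_sphere_zero_iff_norm, norm_smul, norm_inv, norm_norm]
    exact inv_mul_cancel₀ (norm_ne_zero_iff.mpr h)⟩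

/-- The differential at `x` of a map from the sphere to `ℝⁿ`; the tangent space of the sphere at `x`
is in Mathlib a copy of `ℝⁿ⁻¹` (read in the preferred chart at `x`). -/
noncomputable def diffAt {m : ℕ} (Y : Sph m → Euc m) (x : Sph m) :
    EuclideanSpace ℝ (Fin m) →L[ℝ] Euc m :=
  mvfderiv (𝓡 m) Y x

/-- First fundamental form `⟨dY, dY⟩` of the parametrized hypersurface `Y` at `x`, as a matrix. -/
noncomputable def firstForm {m : ℕ} (Y : Sph m → Euc m) (x : Sph m) :
    Matrix (Fin m) (Fin m) ℝ :=
  Matrix.of fun i j =>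
    ⟪diffAt Y x (EuclideanSpace.single i 1), diffAt Y x (EuclideanSpace.single j 1)⟫

/-- Second fundamental form `⟨dY, dN⟩` of the parametrized hypersurface `Y` with outer unit
normal `N` at `x`, as a matrix (positive definite where the hypersurface is strictly convex). -/
noncomputable def secondForm {m : ℕ} (Y : Sph m → Euc m) (N : Sph m → Sph m) (x : Sph m) :
    Matrix (Fin m) (Fin m) ℝ :=
  Matrix.of fun i j =>
    ⟪diffAt Y x (EuclideanSpace.single i 1),
      diffAt (fun z => (N z : Euc m)) x (EuclideanSpace.single j 1)⟫

/-- Gauss curvature `det II / det I` at the point `Y x`, i.e. the product of the principal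
curvatures (the determinant of the Weingarten map `S`, `dN = dY ∘ S`). It does not depend on the
basis in which the two forms are written. -/
noncomputable def gaussCurvature {m : ℕ} (Y : Sph m → Euc m) (N : Sph m → Sph m) (x : Sph m) : ℝ :=
  (secondForm Y N x).det / (firstForm Y x).det

/-- `Y : 𝕊ⁿ⁻¹ → ℝⁿ` is a smooth embedding onto a closed, strictly (= uniformly, by compactness)
convex hypersurface that encloses the origin, and `N` is its outer unit normal. -/
structure IsConvexHypersurface {m : ℕ} (Y : Sph m → Euc m) (N : Sph m → Sph m) : Prop where
  smooth : ContMDiff (𝓡 m) 𝓘(ℝ, Euc m) ∞ Y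
  injective : Function.Injective Y
  immersion : ∀ x, Function.Injective (diffAt Y x)
  /-- the hypersurface is the boundary of its convex hull -/
  convex : range Y = frontier (convexHull ℝ (range Y))
  encloses : (0 : Euc m) ∈ interior (convexHull ℝ (range Y))
  normal : ∀ x v, ⟪diffAt Y x v, (N x : Euc m)⟫ = 0
  outer : ∀ x y, ⟪Y y - Y x, (N x : Euc m)⟫ ≤ 0
  /-- all principal curvatures are positive: the second fundamental form is positive definite -/
  strict : ∀ x v, v ≠ 0 → 0 < ⟪diffAt Y x v, diffAt (fun z => (N z : Euc m)) x v⟫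

/-- The time interval `[0, T)`, where `T = ∞` is allowed. -/
def timeInterval (T : EReal) : Set ℝ := {t | 0 ≤ t ∧ (t : EReal) < T}

/-- `X : 𝕊ⁿ⁻¹ × [0, T) → ℝⁿ` is a smooth, strictly convex solution enclosing the origin of the flow
`∂X/∂t = - f(ν) / g(X/|X|) |X|ⁿ K ν + X`, where `ν(·, t)` is the outer unit normal and `K` the Gauss
curvature of `M_t = X(𝕊ⁿ⁻¹, t)` at `X(x, t)`. The time derivative is one-sided at `t = 0`.
The initial hypersurface is `M_0 = X(𝕊ⁿ⁻¹, 0)`. -/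
structure IsConvexFlow {m : ℕ} (f g : Sph m → ℝ) (T : EReal)
    (X : Sph m → ℝ → Euc m) (ν : Sph m → ℝ → Sph m) : Prop where
  smooth : ContMDiffOn ((𝓡 m).prod 𝓘(ℝ, ℝ)) 𝓘(ℝ, Euc m) ∞
    (fun p : Sph m × ℝ => X p.1 p.2) (univ ×ˢ timeInterval T)
  convex : ∀ t ∈ timeInterval T, IsConvexHypersurface (fun x => X x t) (fun x => ν x t)
  flow : ∀ x, ∀ t ∈ timeInterval T,
    HasDerivWithinAt (fun s => X x s)
      (-(f (ν x t) / g (direction (X x t)) * ‖X x t‖ ^ (m + 1)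
          * gaussCurvature (fun y => X y t) (fun y => ν y t) x) • (ν x t : Euc m) + X x t)
      (timeInterval T) t

/-- Support function `h(x) = max_{y ∈ M} ⟨y, x⟩` of a compact set `M`. -/
noncomputable def supportFn {m : ℕ} (M : Set (Euc m)) (x : Sph m) : ℝ :=
  sSup ((fun y => ⟪y, (x : Euc m)⟫) '' M)

/-- `|∇g| ≤ L` on the sphere: the differential of `g` is bounded by `L` with respect to the
standard metric, i.e. the one induced by the inclusion of the sphere in `ℝⁿ`. -/
def GradBound {m : ℕ} (g : Sph m → ℝ) (L : ℝ) : Prop :=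
  ∀ (x : Sph m) (v : EuclideanSpace ℝ (Fin m)),
    |mvfderiv (𝓡 m) g x v| ≤ L * ‖diffAt (fun z : Sph m => (z : Euc m)) x v‖

/-! This is Tso's argument. Let `Φ = (f/g) |X|ⁿ K` be the normal speed, `h = ⟪X, ν⟫` and `ε =
1/(2c)`, so that `h - ε ≥ ε`. The support function bounds give `1/c ≤ |X| ≤ c`, so `Φ` and `K` are
comparable, and it suffices to bound `Q = Φ/(h - ε)` at its maximum over the sphere and a time
interval `[0, t₁]`. Let `M` be the maximal value. If `M ≤ 1` nothing is needed; if the maximum is at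
time `0`, the initial bound applies.

Otherwise, describe the flow near the maximum by the inverse Gauss map. Let `H(y,t)` be the support
function, extended to be homogeneous of degree one in `y`. Its spatial gradient `P` is the point
with normal `y/|y|`, and `H - ∂ₜH = |y| Φ`. For unit `y` the matrix `A = D²H + y yᵀ` has the
principal radii and `1` as eigenvalues, so `K det A = 1` and `Φ det A = ψ := (f/g) |P|ⁿ`.

Near the maximum, `H - ∂ₜH ≤ M (H - ε|y|)` at the maximal time, with equality at the maximum. The
spatial first order condition gives `∂ₜP = P - M (P - ε y)`; the second order condition bounds `∂ₜA`
from below; the time condition gives `∂ₜΦ/Φ ≥ -M`. Taking the logarithmic derivative of `Φ det A =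
ψ` yields `ε M tr A⁻¹ ≤ M (n + 4ε) + ψ'/ψ` (`trace_inv_le_of_max`). The normal is fixed, so `f(ν)`
is constant in time and `ψ'/ψ` is at most a constant times `|∂ₜP|/|P|`, hence a constant times `M`;
the bound on `∇g` enters here. Now `M` cancels, `tr A⁻¹` is bounded, and so is `K = det A⁻¹ ≤ (tr
A⁻¹)ⁿ` (`gaussCurvature_le_of_max`). -/

open Filter Topology Matrix

/-! ### Calculus on the line -/

/-- Jacobi's formula for the derivative of a determinant along a curve of matrices. -/
theorem hasDerivAt_det {ι : Type*} [Fintype ι] [DecidableEq ι] {A : ℝ → Matrix ι ι ℝ}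
    {A' : Matrix ι ι ℝ} {t : ℝ} (hA : ∀ i j, HasDerivAt (fun s => A s i j) (A' i j) t) :
    HasDerivAt (fun s => (A s).det) ((A t).adjugate * A').trace t := by
  have h1 : HasDerivAt (fun s => ∑ σ : Equiv.Perm ι, (Equiv.Perm.sign σ : ℝ) * ∏ i, A s (σ i) i)
      (∑ σ : Equiv.Perm ι, (Equiv.Perm.sign σ : ℝ) *
        ∑ i, (∏ j ∈ Finset.univ.erase i, A t (σ j) j) • A' (σ i) i) t := by
    refine HasDerivAt.fun_sum fun σ _ => HasDerivAt.const_mul _ ?_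
    exact HasDerivAt.fun_finsetProd fun i _ => hA (σ i) i
  have h2 : ((A t).adjugate * A').trace = ∑ σ : Equiv.Perm ι, (Equiv.Perm.sign σ : ℝ) *
        ∑ i, (∏ j ∈ Finset.univ.erase i, A t (σ j) j) • A' (σ i) i := by
    have h3 : ∀ i, ((A t).adjugate * A') i i = ((A t).updateCol i (fun k => A' k i)).det := by
      intro i
      rw [← Matrix.cramer_apply, Matrix.cramer_eq_adjugate_mulVec]
      rfl
    simp only [Matrix.trace, Matrix.diag, h3, Matrix.det_apply', Finset.mul_sum]
    rw [Finset.sum_comm]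
    refine Finset.sum_congr rfl fun σ _ => Finset.sum_congr rfl fun i _ => ?_
    rw [← Finset.mul_prod_erase Finset.univ _ (Finset.mem_univ i), smul_eq_mul]
    have : ∏ j ∈ Finset.univ.erase i, ((A t).updateCol i fun k => A' k i) (σ j) j
        = ∏ j ∈ Finset.univ.erase i, A t (σ j) j := by
      refine Finset.prod_congr rfl fun j hj => ?_
      rw [Matrix.updateCol_ne (Finset.ne_of_mem_erase hj)]
    rw [this, Matrix.updateCol_self]
    ring
  rw [h2]
  simpa only [Matrix.det_apply'] using h1

/-- A negative second derivative would make the minimum a local maximum as well, hence the function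
locally constant. -/
theorem IsLocalMin.deriv_deriv_nonneg {f : ℝ → ℝ} {a : ℝ} (h : IsLocalMin f a)
    (hf : ContinuousAt f a) : 0 ≤ deriv (deriv f) a := by
  by_contra! hneg
  have hmax : IsLocalMax f a := isLocalMax_of_deriv_deriv_neg hneg h.deriv_eq_zero hf
  have hconst : f =ᶠ[𝓝 a] fun _ => f a := by
    filter_upwards [h, hmax] with x h1 h2 using le_antisymm h2 h1
  have : deriv f =ᶠ[𝓝 a] fun _ => 0 := by
    simpa using hconst.deriv
  rw [this.deriv_eq] at hneg
  simp at hneg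

/-- A function that is nonpositive before `a` and vanishes at `a` has nonnegative derivative. -/
theorem HasDerivAt.nonneg_of_eventually_nonpos_left {f : ℝ → ℝ} {f' a : ℝ}
    (h : HasDerivAt f f' a) (h0 : f a = 0) (hf : ∀ᶠ t in 𝓝[<] a, f t ≤ 0) : 0 ≤ f' := by
  have h1 := (hasDerivAt_iff_tendsto_slope_left_right.1 h).1
  refine ge_of_tendsto h1 ?_
  filter_upwards [hf, self_mem_nhdsWithin] with t ht hlt
  rw [slope_def_field, h0]
  have : t - a < 0 := sub_neg.2 hlt
  exact div_nonneg_of_nonpos (by linarith) this.le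

/-! ### Trace and determinant (in)equalities -/

namespace Matrix

variable {ι : Type*} [Fintype ι] [DecidableEq ι]

open scoped MatrixOrder in
theorem PosDef.trace_inv_mul_nonneg {A S : Matrix ι ι ℝ} (hA : A.PosDef) (hS : S.PosSemidef) :
    0 ≤ (A⁻¹ * S).trace := by
  obtain ⟨B, rfl⟩ := CStarAlgebra.nonneg_iff_eq_star_mul_self.mp hS.nonneg
  rw [Matrix.star_eq_conjTranspose, ← Matrix.mul_assoc, Matrix.trace_mul_comm, ← Matrix.mul_assoc]
  exact (hA.inv.posSemidef.mul_mul_conjTranspose_same B).trace_nonneg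

/-- Each eigenvalue is at most the sum of all; the sharp constant of the arithmetic-geometric mean
inequality is not needed. -/
theorem PosSemidef.det_le_trace_pow {A : Matrix ι ι ℝ} (hA : A.PosSemidef) :
    A.det ≤ A.trace ^ Fintype.card ι := by
  rw [hA.1.det_eq_prod_eigenvalues, hA.1.trace_eq_sum_eigenvalues]
  simp only [RCLike.ofReal_real_eq_id, id]
  calc ∏ i, hA.1.eigenvalues i ≤ ∏ _i : ι, ∑ j, hA.1.eigenvalues j :=
        Finset.prod_le_prod (fun i _ => hA.eigenvalues_nonneg i) fun i _ =>
          Finset.single_le_sum (fun j _ => hA.eigenvalues_nonneg j) (Finset.mem_univ i)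
    _ = _ := by simp [Finset.card_univ]

/-- If `[B | y]` is inverse to `[D ; yᵀ]`, and `y` is a unit vector orthogonal to the columns of
`Y` and `B`, then `det (Yᵀ Y) = det (Yᵀ B) * det (Y D + y yᵀ)`. -/
theorem det_transpose_mul_self_eq {n k : Type*} [Fintype n] [DecidableEq n] [Fintype k]
    [DecidableEq k] (Y B : Matrix n k ℝ) (D : Matrix k n ℝ) (y : n → ℝ) (e : n ≃ k ⊕ Unit)
    (hy : y ⬝ᵥ y = 1) (hBD : B * D + vecMulVec y y = 1) (hY : y ᵥ* Y = 0) (hB : y ᵥ* B = 0) :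
    (Yᵀ * Y).det = (Yᵀ * B).det * (Y * D + vecMulVec y y).det := by
  set c : Matrix n Unit ℝ := replicateCol Unit y
  set r : Matrix Unit n ℝ := replicateRow Unit y
  have hcr : c * r = vecMulVec y y := by
    rw [vecMulVec_eq Unit]
  have hct : cᵀ = r := rfl
  have hrc : r * c = 1 := by
    ext i j
    simp [c, r, Matrix.mul_apply, ← hy, dotProduct]
  have hrY : r * Y = 0 := by
    ext i j
    exact congrFun hY j
  have hrB : r * B = 0 := by
    ext i j
    exact congrFun hB j
  have hYc : Yᵀ * c = 0 := by
    rw [← transpose_inj, transpose_mul, transpose_transpose, hct, hrY, transpose_zero]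
  have h1 : fromCols B c * fromRows D r = 1 := by
    rw [fromCols_mul_fromRows, hcr, hBD]
  have h2 : fromRows D r * fromCols B c = 1 :=
    (Matrix.mul_eq_one_comm_of_equiv e).1 h1
  have h3 : fromCols Y c * fromRows D r = Y * D + vecMulVec y y := by
    rw [fromCols_mul_fromRows, hcr]
  have hYY : (fromRows Yᵀ r * fromCols Y c).det = (Yᵀ * Y).det := by
    rw [fromRows_mul_fromCols, hYc, hrY, hrc, det_fromBlocks_zero₂₁, det_one, mul_one]
  have hYB : (fromRows Yᵀ r * fromCols B c).det = (Yᵀ * B).det := by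
    rw [fromRows_mul_fromCols, hYc, hrB, hrc, det_fromBlocks_zero₂₁, det_one, mul_one]
  -- Adjoining the column `y` makes all matrices square. Multiplying this identity by `[Y | y]ᵀ` on
  -- the left gives products that are block diagonal with corner `1`.
  have h4 : fromCols Y c = (Y * D + vecMulVec y y) * fromCols B c := by
    rw [← h3, Matrix.mul_assoc, h2, Matrix.mul_one]
  rw [← hYY, ← hYB, ← det_conj_of_mul_eq_one h2 h1 (N := Y * D + vecMulVec y y), ← det_mul]
  congr 1
  rw [h4]
  simp only [Matrix.mul_assoc]
  rw [← Matrix.mul_assoc (fromCols B c) (fromRows D r), h1, Matrix.one_mul]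

end Matrix

/-! ### Derivatives along constant vector fields -/

section DirDeriv

variable {V W : Type*} [NormedAddCommGroup V] [NormedSpace ℝ V] [NormedAddCommGroup W]
  [NormedSpace ℝ W] {Ω : Set V} {F G : V → W} {p v w : V}

/-- The derivative of `F` in the direction of the constant vector field `v`. -/
noncomputable def dirDeriv (v : V) (F : V → W) : V → W := fun p => fderiv ℝ F p v

theorem ContDiffOn.contDiffAt_of_isOpen (hF : ContDiffOn ℝ ∞ F Ω) (hΩ : IsOpen Ω) (hp : p ∈ Ω) :
    ContDiffAt ℝ ∞ F p := hF.contDiffAt (hΩ.mem_nhds hp)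

theorem ContDiffOn.differentiableAt_of_isOpen (hF : ContDiffOn ℝ ∞ F Ω) (hΩ : IsOpen Ω)
    (hp : p ∈ Ω) : DifferentiableAt ℝ F p :=
  (hF.contDiffAt_of_isOpen hΩ hp).differentiableAt (by simp)

theorem ContDiffOn.dirDeriv (hF : ContDiffOn ℝ ∞ F Ω) (hΩ : IsOpen Ω) (v : V) :
    ContDiffOn ℝ ∞ (dirDeriv v F) Ω :=
  (hF.fderiv_of_isOpen hΩ (by simp)).clm_apply contDiffOn_const

theorem HasFDerivAt.dirDeriv_eq {F' : V →L[ℝ] W} (h : HasFDerivAt F F' p) :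
    dirDeriv v F p = F' v := by rw [dirDeriv, h.fderiv]

theorem dirDeriv_congr (hΩ : IsOpen Ω) (h : ∀ q ∈ Ω, F q = G q) (hp : p ∈ Ω) :
    dirDeriv v F p = dirDeriv v G p := by
  have : F =ᶠ[𝓝 p] G := by
    filter_upwards [hΩ.mem_nhds hp] with q hq using h q hq
  simp only [dirDeriv, this.fderiv_eq]

theorem dirDeriv_dirDeriv (hF : ContDiffOn ℝ ∞ F Ω) (hΩ : IsOpen Ω) (hp : p ∈ Ω) :
    dirDeriv v (dirDeriv w F) p = fderiv ℝ (fderiv ℝ F) p v w := by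
  have h := (hF.fderiv_of_isOpen hΩ (m := ∞) (by simp)).differentiableAt_of_isOpen hΩ hp
  have h2 : HasFDerivAt (dirDeriv w F) _ p := h.hasFDerivAt.clm_apply (hasFDerivAt_const w p)
  rw [h2.dirDeriv_eq]
  simp

theorem dirDeriv_comm (hF : ContDiffOn ℝ ∞ F Ω) (hΩ : IsOpen Ω) (hp : p ∈ Ω) :
    dirDeriv v (dirDeriv w F) p = dirDeriv w (dirDeriv v F) p := by
  rw [dirDeriv_dirDeriv hF hΩ hp, dirDeriv_dirDeriv hF hΩ hp]
  exact (hF.contDiffAt_of_isOpen hΩ hp).isSymmSndFDerivAt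
    (by simpa using! (mod_cast le_top : ((2 : ℕ∞) : ℕ∞ω) ≤ ∞)) v w

/-- First and second order conditions at a minimum on an affine subspace. -/
theorem dirDeriv_eq_zero_of_min {F : V → ℝ} (hF : ContDiffOn ℝ ∞ F Ω) (hΩ : IsOpen Ω) (hp : p ∈ Ω)
    (hmin : ∀ᶠ s : ℝ in 𝓝 0, F p ≤ F (p + s • v)) :
    dirDeriv v F p = 0 ∧ 0 ≤ dirDeriv v (dirDeriv v F) p := by
  have hline : ∀ s : ℝ, HasDerivAt (fun s : ℝ => p + s • v) v s := fun s => by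
    simpa using ((hasDerivAt_id s).smul_const v).const_add p
  have hmem : ∀ᶠ s : ℝ in 𝓝 0, p + s • v ∈ Ω := by
    refine (hline 0).continuousAt.eventually_mem (hΩ.mem_nhds ?_)
    simpa using hp
  have hder : ∀ {G : V → ℝ}, ContDiffOn ℝ ∞ G Ω → ∀ s : ℝ, p + s • v ∈ Ω →
      HasDerivAt (fun s : ℝ => G (p + s • v)) (dirDeriv v G (p + s • v)) s := fun {G} hG s hs =>
    (hG.differentiableAt_of_isOpen hΩ hs).hasFDerivAt.comp_hasDerivAt s (hline s)
  have h0 : p + (0 : ℝ) • v = p := by simp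
  have hloc : IsLocalMin (fun s : ℝ => F (p + s • v)) 0 := by
    simpa [IsLocalMin, IsMinFilter] using hmin
  have hd0 := hder hF 0 (by rwa [h0])
  have hdd0 := hder (hF.dirDeriv hΩ v) 0 (by rwa [h0])
  rw [h0] at hd0 hdd0
  refine ⟨hd0.deriv ▸ hloc.deriv_eq_zero, ?_⟩
  have h2 : deriv (fun s : ℝ => F (p + s • v)) =ᶠ[𝓝 0] fun s => dirDeriv v F (p + s • v) := by
    filter_upwards [hmem] with s hs using (hder hF s hs).deriv
  have := hloc.deriv_deriv_nonneg hd0.continuousAt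
  rwa [h2.deriv_eq, hdd0.deriv] at this

end DirDeriv

/-! ### The maximum principle for the homogeneous support function -/

section Model

variable {m : ℕ}

/-- A smooth function touching the norm from below to second order along the unit sphere. -/
noncomputable def subNorm (p : Euc m × ℝ) : ℝ := (3 * ‖p.1‖ ^ 2 - ‖p.1‖ ^ 4) / 2

theorem subNorm_le (p : Euc m × ℝ) : subNorm p ≤ ‖p.1‖ := by
  have h := norm_nonneg p.1
  unfold subNorm
  -- With `r = ‖p.1‖`, the difference `r - (3r² - r⁴)/2` equals `r (r - 1)² (r + 2) / 2`.
  nlinarith [mul_nonneg (mul_nonneg h (sq_nonneg (‖p.1‖ - 1))) (by linarith : 0 ≤ ‖p.1‖ + 2)]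

theorem subNorm_of_norm_eq_one {p : Euc m × ℝ} (hp : ‖p.1‖ = 1) : subNorm p = 1 := by
  norm_num [subNorm, hp]

theorem subNorm_eq : (subNorm : Euc m × ℝ → ℝ) =
    fun p => (3 * ⟪p.1, p.1⟫ - ⟪p.1, p.1⟫ ^ 2) / 2 := by
  ext p
  simp only [subNorm, real_inner_self_eq_norm_sq]
  ring

theorem contDiff_subNorm : ContDiff ℝ ∞ (subNorm : Euc m × ℝ → ℝ) := by
  rw [subNorm_eq]
  have : ContDiff ℝ ∞ fun p : Euc m × ℝ => ⟪p.1, p.1⟫ := contDiff_fst.inner ℝ contDiff_fst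
  exact ((contDiff_const.mul this).sub (this.pow 2)).div_const 2

theorem hasFDerivAt_inner_fst_self (p : Euc m × ℝ) (v : Euc m) (s : ℝ) :
    ∃ F' : Euc m × ℝ →L[ℝ] ℝ, HasFDerivAt (fun p : Euc m × ℝ => ⟪p.1, p.1⟫) F' p ∧
      F' (v, s) = 2 * ⟪p.1, v⟫ := by
  have h : HasFDerivAt (fun p : Euc m × ℝ => p.1) (ContinuousLinearMap.fst ℝ (Euc m) ℝ) p :=
    hasFDerivAt_fst
  refine ⟨_, h.inner ℝ h, ?_⟩
  simp [fderivInnerCLM_apply, real_inner_comm]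
  ring

theorem dirDeriv_subNorm (w : Euc m) : dirDeriv (w, (0 : ℝ)) (subNorm : Euc m × ℝ → ℝ) =
    fun p => (3 - 2 * ⟪p.1, p.1⟫) * ⟪p.1, w⟫ := by
  ext p
  obtain ⟨F', h1, h2⟩ := hasFDerivAt_inner_fst_self p w 0
  have := ((h1.const_mul 3).fun_sub (h1.pow 2)).mul_const ((2 : ℝ)⁻¹)
  rw [subNorm_eq]
  simp only [div_eq_mul_inv]
  rw [HasFDerivAt.dirDeriv_eq this]
  simp [h2]
  ring

theorem dirDeriv_dirDeriv_subNorm {p : Euc m × ℝ} (hp : ‖p.1‖ = 1) (v w : Euc m) :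
    dirDeriv (v, (0 : ℝ)) (dirDeriv (w, (0 : ℝ)) subNorm) p =
      ⟪v, w⟫ - 4 * (⟪p.1, v⟫ * ⟪p.1, w⟫) := by
  obtain ⟨F', h1, h2⟩ := hasFDerivAt_inner_fst_self p v 0
  have h3 : HasFDerivAt (fun p : Euc m × ℝ => p.1) (ContinuousLinearMap.fst ℝ (Euc m) ℝ) p :=
    hasFDerivAt_fst
  have h4 := h3.inner ℝ (hasFDerivAt_const w p)
  rw [dirDeriv_subNorm, HasFDerivAt.dirDeriv_eq (((h1.const_mul 2).const_sub 3).fun_mul h4)]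
  simp [h2, fderivInnerCLM_apply, hp]
  ring

/-- The matrix of second derivatives in the space variable. -/
noncomputable def spatialHessian (H : Euc m × ℝ → ℝ) (p : Euc m × ℝ) :
    Matrix (Fin (m + 1)) (Fin (m + 1)) ℝ :=
  Matrix.of fun i j =>
    dirDeriv (EuclideanSpace.single i 1, (0 : ℝ)) (dirDeriv (EuclideanSpace.single j 1, (0 : ℝ)) H) p

theorem dotProduct_spatialHessian_mulVec {Ω : Set (Euc m × ℝ)} {H : Euc m × ℝ → ℝ}
    {p : Euc m × ℝ} (hH : ContDiffOn ℝ ∞ H Ω) (hΩ : IsOpen Ω) (hp : p ∈ Ω)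
    (x z : Fin (m + 1) → ℝ) :
    x ⬝ᵥ (spatialHessian H p *ᵥ z) = dirDeriv (WithLp.toLp 2 x, (0 : ℝ))
      (dirDeriv (WithLp.toLp 2 z, (0 : ℝ)) H) p := by
  have hsum : ∀ x : Fin (m + 1) → ℝ, ((WithLp.toLp 2 x, 0) : Euc m × ℝ) =
      ∑ i, x i • ((EuclideanSpace.single i 1, 0) : Euc m × ℝ) := by
    intro x
    ext j
    · simp [Prod.fst_sum, Finset.sum_apply, Pi.single_apply]
    · simp [Prod.snd_sum]
  rw [dirDeriv_dirDeriv hH hΩ hp, hsum x, hsum z]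
  simp only [map_sum, map_smul, _root_.sum_apply, _root_.smul_apply,
    dotProduct, mulVec, spatialHessian, Matrix.of_apply, dirDeriv_dirDeriv hH hΩ hp, smul_eq_mul,
    Finset.mul_sum]
  rw [Finset.sum_comm]
  exact Finset.sum_congr rfl fun i _ => Finset.sum_congr rfl fun j _ => by ring

theorem HasFDerivAt.hasDerivAt_time {V W : Type*} [NormedAddCommGroup V] [NormedSpace ℝ V]
    [NormedAddCommGroup W] [NormedSpace ℝ W] {F : V × ℝ → W} {y : V} {t : ℝ}
    (hF : DifferentiableAt ℝ F (y, t)) :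
    HasDerivAt (fun s => F (y, s)) (dirDeriv (0, 1) F (y, t)) t := by
  have h : HasDerivAt (fun s : ℝ => ((y, s) : V × ℝ)) (0, 1) t :=
    (hasDerivAt_const t y).prodMk (hasDerivAt_id t)
  exact hF.hasFDerivAt.comp_hasDerivAt t h

/-- The speed `H - ∂ₜ H` of the flow in terms of the homogeneous support function. -/
noncomputable def supportSpeed (H : Euc m × ℝ → ℝ) (p : Euc m × ℝ) : ℝ :=
  H p - dirDeriv (0, 1) H p

section Max

variable {Ω : Set (Euc m × ℝ)} {H : Euc m × ℝ → ℝ} {P : Euc m × ℝ → Euc m} {y : Euc m}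
  {t₀ M ε : ℝ}

theorem contDiffOn_supportSpeed (hH : ContDiffOn ℝ ∞ H Ω) (hΩ : IsOpen Ω) :
    ContDiffOn ℝ ∞ (supportSpeed H) Ω := hH.sub (hH.dirDeriv hΩ _)

/-- The function which has a spatial minimum where `supportSpeed H / (H - ε |y|)` is maximal. -/
noncomputable def speedGap (H : Euc m × ℝ → ℝ) (M ε : ℝ) (p : Euc m × ℝ) : ℝ :=
  M * (H p - ε * subNorm p) - supportSpeed H p

theorem contDiffOn_speedGap (hH : ContDiffOn ℝ ∞ H Ω) (hΩ : IsOpen Ω) :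
    ContDiffOn ℝ ∞ (speedGap H M ε) Ω :=
  (contDiffOn_const.mul (hH.sub (contDiffOn_const.mul contDiff_subNorm.contDiffOn))).sub
    (contDiffOn_supportSpeed hH hΩ)

theorem dirDeriv_speedGap (hH : ContDiffOn ℝ ∞ H Ω) (hΩ : IsOpen Ω) {p v : Euc m × ℝ}
    (hp : p ∈ Ω) : dirDeriv v (speedGap H M ε) p =
      M * (dirDeriv v H p - ε * dirDeriv v subNorm p) -
        (dirDeriv v H p - dirDeriv v (dirDeriv (0, 1) H) p) := by
  have h1 := hH.differentiableAt_of_isOpen hΩ hp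
  have h2 := (hH.dirDeriv hΩ (0, 1)).differentiableAt_of_isOpen hΩ hp
  have h3 : DifferentiableAt ℝ subNorm p := contDiff_subNorm.contDiffAt.differentiableAt (by simp)
  exact (((h1.hasFDerivAt.sub (h3.hasFDerivAt.const_mul ε)).const_mul M).sub
    (h1.hasFDerivAt.sub h2.hasFDerivAt)).dirDeriv_eq

/-- The time derivative is moved outermost, so that the spatial Hessian of the gap exhibits the time
derivative of the Hessian of `H`, as required by Jacobi's formula. -/
theorem dirDeriv_dirDeriv_speedGap (hH : ContDiffOn ℝ ∞ H Ω) (hΩ : IsOpen Ω) {p v w : Euc m × ℝ}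
    (hp : p ∈ Ω) : dirDeriv v (dirDeriv w (speedGap H M ε)) p =
      M * (dirDeriv v (dirDeriv w H) p - ε * dirDeriv v (dirDeriv w subNorm) p) -
        (dirDeriv v (dirDeriv w H) p - dirDeriv (0, 1) (dirDeriv v (dirDeriv w H)) p) := by
  rw [dirDeriv_congr hΩ (fun q hq => dirDeriv_speedGap hH hΩ hq) hp,
    dirDeriv_comm (hH.dirDeriv hΩ w) hΩ hp, dirDeriv_congr hΩ
      (fun q hq => dirDeriv_comm (v := (0, 1)) (w := w) hH hΩ hq) hp]
  have h1 := (hH.dirDeriv hΩ w).differentiableAt_of_isOpen hΩ hp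
  have h2 := ((hH.dirDeriv hΩ (0, 1)).dirDeriv hΩ w).differentiableAt_of_isOpen hΩ hp
  have h3 : DifferentiableAt ℝ (dirDeriv w subNorm) p :=
    (contDiff_subNorm.contDiffOn.dirDeriv isOpen_univ w).differentiableAt_of_isOpen isOpen_univ
      (mem_univ p)
  exact (((h1.hasFDerivAt.sub (h3.hasFDerivAt.const_mul ε)).const_mul M).sub
    (h1.hasFDerivAt.sub h2.hasFDerivAt)).dirDeriv_eq

/-- Replacing `|z|` by the smaller `subNorm` only enlarges the gap, and the two agree at the unit
vector `y`. So the minimum is over all directions, including the radial one. -/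
theorem speedGap_min (hy : ‖y‖ = 1) (hM : 0 ≤ M) (hε : 0 ≤ ε)
    (heq : supportSpeed H (y, t₀) = M * (H (y, t₀) - ε))
    (hspace : ∀ᶠ z in 𝓝 y, supportSpeed H (z, t₀) ≤ M * (H (z, t₀) - ε * ‖z‖)) (w : Euc m) :
    ∀ᶠ s : ℝ in 𝓝 0, speedGap H M ε (y, t₀) ≤ speedGap H M ε ((y, t₀) + s • (w, (0 : ℝ))) := by
  have hcont : Tendsto (fun s : ℝ => y + s • w) (𝓝 0) (𝓝 y) := by
    have : Continuous fun s : ℝ => y + s • w := by fun_prop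
    simpa using this.tendsto 0
  have h0 : speedGap H M ε (y, t₀) = 0 := by
    simp only [speedGap]
    rw [subNorm_of_norm_eq_one (by exact hy), heq]
    ring
  filter_upwards [hcont.eventually hspace] with s hs
  rw [h0]
  have h1 := subNorm_le (y + s • w, t₀)
  have h2 := mul_le_mul_of_nonneg_left (mul_le_mul_of_nonneg_left h1 hε) hM
  simp only [Prod.mk_add_mk, Prod.smul_mk, smul_zero, add_zero, speedGap]
  dsimp only at h2
  linarith

/-- The velocity of the point with a fixed normal at a spatial maximum. -/
theorem hasDerivAt_gradient (hΩ : IsOpen Ω) (hH : ContDiffOn ℝ ∞ H Ω)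
    (hP : ∀ p ∈ Ω, ∀ w, dirDeriv (w, (0 : ℝ)) H p = ⟪P p, w⟫) (hmem : (y, t₀) ∈ Ω)
    (hPd : DifferentiableAt ℝ P (y, t₀)) (hy : ‖y‖ = 1) (hM : 0 ≤ M) (hε : 0 ≤ ε)
    (heq : supportSpeed H (y, t₀) = M * (H (y, t₀) - ε))
    (hspace : ∀ᶠ z in 𝓝 y, supportSpeed H (z, t₀) ≤ M * (H (z, t₀) - ε * ‖z‖)) :
    HasDerivAt (fun t => P (y, t)) (P (y, t₀) - M • (P (y, t₀) - ε • y)) t₀ := by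
  have h1 := HasFDerivAt.hasDerivAt_time hPd
  convert! h1 using 1
  refine ext_inner_right ℝ fun w => ?_
  have h2 := (dirDeriv_eq_zero_of_min (contDiffOn_speedGap hH hΩ) hΩ hmem
    (speedGap_min hy hM hε heq hspace w)).1
  rw [dirDeriv_speedGap hH hΩ hmem, dirDeriv_comm hH hΩ hmem, dirDeriv_congr hΩ
    (fun q hq => hP q hq w) hmem, hP _ hmem, dirDeriv_subNorm,
    HasFDerivAt.dirDeriv_eq (hPd.hasFDerivAt.inner ℝ (hasFDerivAt_const w _))] at h2
  simp [fderivInnerCLM_apply, hy] at h2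
  simp only [inner_sub_left, real_inner_smul_left, dirDeriv]
  linarith

/-- The estimate at a maximum of `supportSpeed H / (H - ε)`. -/
theorem trace_inv_le_of_max (hΩ : IsOpen Ω) (hH : ContDiffOn ℝ ∞ H Ω)
    (hmem : (y, t₀) ∈ Ω) (hy : ‖y‖ = 1) (hM : 0 < M) (hε : 0 ≤ ε)
    (hHpos : 0 ≤ H (y, t₀)) (hHε : ε < H (y, t₀))
    (heq : supportSpeed H (y, t₀) = M * (H (y, t₀) - ε))
    (hspace : ∀ᶠ z in 𝓝 y, supportSpeed H (z, t₀) ≤ M * (H (z, t₀) - ε * ‖z‖))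
    (htime : ∀ᶠ t in 𝓝[<] t₀, supportSpeed H (y, t) ≤ M * (H (y, t) - ε))
    (hpos : (spatialHessian H (y, t₀) + vecMulVec y y).PosDef)
    (hker : spatialHessian H (y, t₀) *ᵥ y = 0) {ψ : ℝ → ℝ} {ψ' : ℝ} (hψ : HasDerivAt ψ ψ' t₀)
    (hspeed : ∀ᶠ t in 𝓝 t₀,
      supportSpeed H (y, t) * (spatialHessian H (y, t) + vecMulVec y y).det = ψ t) :
    ε * M * ((spatialHessian H (y, t₀) + vecMulVec y y)⁻¹).trace ≤
      M * (m + 1 + 4 * ε) + ψ' / ψ t₀ := by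
  set A : ℝ → Matrix (Fin (m + 1)) (Fin (m + 1)) ℝ :=
    fun t => spatialHessian H (y, t) + vecMulVec y y with hA
  set R := spatialHessian H (y, t₀) with hR
  set S := spatialHessian (speedGap H M ε) (y, t₀) with hS
  have hyy : (y : Fin (m + 1) → ℝ) ⬝ᵥ y = 1 := by
    have := real_inner_self_eq_norm_sq y
    rw [hy, one_pow] at this
    rw [← this, PiLp.inner_apply]
    rfl
  have hΦ := contDiffOn_supportSpeed hH hΩ
  set Φ' := dirDeriv (0, 1) (supportSpeed H) (y, t₀)
  have hΦd : HasDerivAt (fun t => supportSpeed H (y, t)) Φ' t₀ :=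
    HasFDerivAt.hasDerivAt_time (hΦ.differentiableAt_of_isOpen hΩ hmem)
  have hHd : HasDerivAt (fun t => H (y, t)) (H (y, t₀) - M * (H (y, t₀) - ε)) t₀ := by
    have := HasFDerivAt.hasDerivAt_time (hH.differentiableAt_of_isOpen hΩ hmem)
    convert! this using 1
    rw [← heq, supportSpeed]
    ring
  have htime' : 0 ≤ Φ' - M * (H (y, t₀) - M * (H (y, t₀) - ε)) := by
    refine (hΦd.sub ((hHd.sub_const ε).const_mul M)).nonneg_of_eventually_nonpos_left ?_ ?_
    · simp [heq]
    · filter_upwards [htime] with t ht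
      simpa using ht
  -- The Hessian `S` of the gap is `M (R - ε D²subNorm) - (R - ∂ₜR)`; this is that relation solved
  -- for `∂ₜR`.
  set A' : Matrix (Fin (m + 1)) (Fin (m + 1)) ℝ :=
    (1 - M) • R + (M * ε) • (1 - (4 : ℝ) • vecMulVec y y) + S with hA'
  have hAd : ∀ i j, HasDerivAt (fun t => A t i j) (A' i j) t₀ := by
    intro i j
    have h1 := HasFDerivAt.hasDerivAt_time ((((hH.dirDeriv hΩ (EuclideanSpace.single j 1, 0)).dirDeriv hΩ
      (EuclideanSpace.single i 1, 0)).differentiableAt_of_isOpen hΩ hmem))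
    have h2 : HasDerivAt (fun t => A t i j) _ t₀ := h1.add_const (vecMulVec y y i j)
    convert! h2 using 1
    have h3 := dirDeriv_dirDeriv_speedGap (M := M) (ε := ε) hH hΩ hmem
      (v := (EuclideanSpace.single i 1, 0)) (w := (EuclideanSpace.single j 1, 0))
    rw [dirDeriv_dirDeriv_subNorm (by exact hy)] at h3
    simp [EuclideanSpace.inner_single_right] at h3
    simp [hA', hS, hR, spatialHessian, vecMulVec_apply, Matrix.one_apply, h3,
      eq_comm (a := j)]
    ring
  have hdet := (hasDerivAt_det hAd)
  have hApos : (A t₀).PosDef := hpos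
  have hdetpos := hApos.det_pos
  have hSpos : S.PosSemidef := by
    refine .of_dotProduct_mulVec_nonneg ?_ fun x => ?_
    · ext i j
      exact dirDeriv_comm (contDiffOn_speedGap hH hΩ) hΩ hmem
    · rw [star_trivial, dotProduct_spatialHessian_mulVec (contDiffOn_speedGap hH hΩ) hΩ hmem]
      exact (dirDeriv_eq_zero_of_min (contDiffOn_speedGap hH hΩ) hΩ hmem
        (speedGap_min hy hM.le hε heq hspace _)).2
  have hunit : IsUnit (A t₀).det := hdetpos.ne'.isUnit
  -- The radial direction is the eigenvector added by `y yᵀ`, with eigenvalue `1`; hence `tr (A⁻¹ R)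
  -- = m` below.
  have hAy : (A t₀) *ᵥ y = y := by
    rw [hA]
    simp only [add_mulVec, ← hR, hker, vecMulVec_mulVec, hyy]
    simp
  have hAinv : (A t₀)⁻¹ *ᵥ y = y := by
    conv_lhs => rw [← hAy]
    rw [mulVec_mulVec, nonsing_inv_mul _ hunit, one_mulVec]
  have htrY : ((A t₀)⁻¹ * vecMulVec y y).trace = 1 := by
    rw [mul_vecMulVec, hAinv, trace_vecMulVec, hyy]
  have htrR : ((A t₀)⁻¹ * R).trace = m := by
    have : R = A t₀ - vecMulVec y y := by rw [hA]; simp [hR]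
    rw [this, mul_sub, trace_sub, nonsing_inv_mul _ hunit, htrY]
    simp
  have htr : ((A t₀)⁻¹ * A').trace = (1 - M) * m + M * ε * (((A t₀)⁻¹).trace - 4) +
      ((A t₀)⁻¹ * S).trace := by
    rw [hA']
    simp only [mul_add, mul_sub, Matrix.mul_smul, trace_add, trace_sub, trace_smul, htrR, htrY,
      mul_one, smul_eq_mul]
  have hS0 := hApos.trace_inv_mul_nonneg hSpos
  have hadj : ((A t₀).adjugate * A').trace = (A t₀).det * ((A t₀)⁻¹ * A').trace := by
    rw [inv_def, smul_mul, trace_smul, smul_eq_mul, Ring.inverse_eq_inv', ← mul_assoc,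
      mul_inv_cancel₀ hdetpos.ne', one_mul]
  rw [hadj] at hdet
  have hprod := (hΦd.mul hdet).unique (hψ.congr_of_eventuallyEq hspeed)
  have hψ0 : supportSpeed H (y, t₀) * (A t₀).det = ψ t₀ := hspeed.self_of_nhds
  have hΦpos : 0 < supportSpeed H (y, t₀) := heq ▸ mul_pos hM (sub_pos.2 hHε)
  -- Logarithmic derivative of `Φ det A = ψ`.
  have hratio : ψ' / ψ t₀ = Φ' / supportSpeed H (y, t₀) + ((A t₀)⁻¹ * A').trace := by
    rw [← hprod, ← hψ0]
    field_simp
  -- By the time condition, `Φ' ≥ M (H - M (H - ε))`, and `Φ = M (H - ε)`; the term `M H` is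
  -- dropped.
  have hΦratio : -M ≤ Φ' / supportSpeed H (y, t₀) := by
    rw [le_div_iff₀ hΦpos, heq]
    nlinarith [mul_nonneg hM.le hHpos]
  have hm0 : (0 : ℝ) ≤ m := Nat.cast_nonneg m
  change ε * M * ((A t₀)⁻¹).trace ≤ _
  rw [hratio, htr]
  nlinarith

end Max

end Model

/-! ### Implicit functions -/

/-- A smooth function has a smooth implicit function on a whole neighborhood. -/
theorem exists_contDiffOn_implicit {E₁ E₂ F : Type*} [NormedAddCommGroup E₁] [NormedSpace ℝ E₁]
    [CompleteSpace E₁] [NormedAddCommGroup E₂] [NormedSpace ℝ E₂] [CompleteSpace E₂]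
    [NormedAddCommGroup F] [NormedSpace ℝ F] [CompleteSpace F] {f : E₁ × E₂ → F}
    {U : Set (E₁ × E₂)} (hU : IsOpen U) (hf : ContDiffOn ℝ ∞ f U) {p : E₁} {u : E₂}
    (hmem : (p, u) ∈ U) (hfp : f (p, u) = 0)
    (hinv : (fderiv ℝ f (p, u) ∘L .inr ℝ E₁ E₂).IsInvertible) :
    ∃ (Ω : Set E₁) (ψ : E₁ → E₂), IsOpen Ω ∧ p ∈ Ω ∧ ContDiffOn ℝ ∞ ψ Ω ∧ ψ p = u ∧
      ∀ q ∈ Ω, (q, ψ q) ∈ U ∧ f (q, ψ q) = 0 := by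
  have h0 : (∞ : ℕ∞ω) ≠ 0 := by simp
  have hfd : ∀ {z}, z ∈ U → ContDiffAt ℝ ∞ f z := fun hz => hf.contDiffAt (hU.mem_nhds hz)
  set ψ := (hfd hmem).implicitFunction h0 hinv with hψ
  have hψs : ContDiffAt ℝ ∞ ψ p := (hfd hmem).contDiffAt_implicitFunction h0 hinv
  have hψp : ψ p = u := (hfd hmem).implicitFunction_apply_self h0 hinv
  have hgraph : ContinuousAt (fun q => (q, ψ q)) p := continuousAt_id.prodMk hψs.continuousAt
  have htend : Tendsto (fun q => (q, ψ q)) (𝓝 p) (𝓝 (p, u)) := by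
    simpa only [ContinuousAt, hψp] using hgraph
  have e1 : ∀ᶠ q in 𝓝 p, f (q, ψ q) = 0 := by
    simpa only [hfp] using (hfd hmem).eventually_apply_implicitFunction h0 hinv
  have e2 : ∀ᶠ q in 𝓝 p, (q, ψ q) ∈ U := htend.eventually (hU.mem_nhds hmem)
  have e3 : ∀ᶠ q in 𝓝 p, (fderiv ℝ f (q, ψ q) ∘L .inr ℝ E₁ E₂).IsInvertible := by
    obtain ⟨e, he⟩ := hinv
    have hcont : ContinuousAt (fun z => fderiv ℝ f z ∘L .inr ℝ E₁ E₂) (p, u) :=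
      ((hfd hmem).continuousAt_fderiv h0).clm_comp continuousAt_const
    have := e.nhds
    rw [he] at this
    exact htend.eventually (hcont.eventually_mem this)
  have e4 : ∀ᶠ q in 𝓝 p, ContinuousAt ψ q := by
    filter_upwards [(hψs.of_le (m := 1) (by simp)).eventually (by simp)] with q hq
      using hq.continuousAt
  obtain ⟨Ω, hΩ, hΩo, hpΩ⟩ := _root_.eventually_nhds_iff.1
    (e1.and (e2.and (e3.and (e4.and (htend.eventually
      (((hfd hmem).eventually_apply_eq_iff_implicitFunction h0 hinv).eventually_nhds))))))
  refine ⟨Ω, ψ, hΩo, hpΩ, fun q hq => ?_, hψp, fun q hq => ⟨(hΩ q hq).2.1, (hΩ q hq).1⟩⟩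
  obtain ⟨h1, h2, h3, h4, h5⟩ := hΩ q hq
  -- Smoothness to order `∞` at the single point `p` gives no common neighborhood for all orders. So
  -- the implicit function theorem is applied again at each nearby `q`, and local uniqueness
  -- identifies the new function with `ψ`.
  have hs := (hfd h2).contDiffAt_implicitFunction h0 h3
  have hself := (hfd h2).implicitFunction_apply_self h0 h3
  refine (hs.congr_of_eventuallyEq ?_).contDiffWithinAt
  have h6 : Tendsto (fun q' => (q', (hfd h2).implicitFunction h0 h3 q')) (𝓝 q) (𝓝 (q, ψ q)) := by
    have := (continuousAt_id (x := q)).prodMk hs.continuousAt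
    simpa only [ContinuousAt, hself, id] using this
  filter_upwards [(hfd h2).eventually_apply_implicitFunction h0 h3, h6.eventually h5] with q' h7 h8
  rw [hfp, h7, h1] at h8
  exact h8.1 rfl

/-! ### Stereographic parametrization of the sphere -/

section Chart

variable {m : ℕ}

/-- The inverse of the stereographic chart at `x₀`. -/
noncomputable def sphParam (x₀ : Sph m) : EuclideanSpace ℝ (Fin m) → Sph m :=
  (extChartAt (𝓡 m) x₀).symm

theorem sphChart_target (x₀ : Sph m) : (extChartAt (𝓡 m) x₀).target = univ := by
  simp [chartAt, ChartedSpace.chartAt]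

theorem contMDiff_sphParam (x₀ : Sph m) :
    ContMDiff 𝓘(ℝ, EuclideanSpace ℝ (Fin m)) (𝓡 m) ∞ (sphParam x₀) := by
  have h := contMDiffOn_extChartAt_symm (I := 𝓡 m) (n := ∞) x₀
  rw [sphChart_target, contMDiffOn_univ] at h
  exact h

theorem sphParam_extChartAt (x₀ : Sph m) : sphParam x₀ (extChartAt (𝓡 m) x₀ x₀) = x₀ :=
  extChartAt_to_inv x₀

theorem sphParam_extChartAt_eventually (x₀ : Sph m) :
    ∀ᶠ x in 𝓝 x₀, sphParam x₀ (extChartAt (𝓡 m) x₀ x) = x := by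
  filter_upwards [extChartAt_source_mem_nhds (I := 𝓡 m) x₀] with x hx
    using (extChartAt (𝓡 m) x₀).left_inv hx

/-- The derivative of the parametrization `sphParam`. -/
noncomputable def sphParamDeriv (x₀ : Sph m) (u : EuclideanSpace ℝ (Fin m)) :
    EuclideanSpace ℝ (Fin m) →L[ℝ] EuclideanSpace ℝ (Fin m) :=
  mfderiv 𝓘(ℝ, EuclideanSpace ℝ (Fin m)) (𝓡 m) (sphParam x₀) u

theorem isInvertible_sphParamDeriv (x₀ : Sph m) (u : EuclideanSpace ℝ (Fin m)) :
    (sphParamDeriv x₀ u).IsInvertible := by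
  have h := isInvertible_mfderivWithin_extChartAt_symm (I := 𝓡 m) (x := x₀) (y := u)
    (by rw [sphChart_target]; trivial)
  rw [modelWithCornersSelf_coe, range_id, mfderivWithin_univ] at h
  exact h

theorem hasFDerivAt_comp_sphParam {F : Sph m → Euc m} {x₀ : Sph m}
    {u : EuclideanSpace ℝ (Fin m)} (hF : MDifferentiableAt (𝓡 m) 𝓘(ℝ, Euc m) F (sphParam x₀ u)) :
    HasFDerivAt (fun v => F (sphParam x₀ v))
      ((diffAt F (sphParam x₀ u)).comp (sphParamDeriv x₀ u)) u := by
  have h1 := ((contMDiff_sphParam x₀).mdifferentiableAt (by simp) (x := u)).hasMFDerivAt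
  exact (hF.hasMFDerivAt.comp u h1).hasFDerivAt

end Chart

/-! ### Normals of convex hypersurfaces -/

section Hypersurface

variable {m : ℕ} {Y : Sph m → Euc m} {N : Sph m → Sph m}

theorem diffAt_eq_zero_of_isLocalMax {x : Sph m} {z : Euc m}
    (hY : MDifferentiableAt (𝓡 m) 𝓘(ℝ, Euc m) Y x) (hmax : ∀ y, ⟪Y y - Y x, z⟫ ≤ 0)
    (v : EuclideanSpace ℝ (Fin m)) : ⟪diffAt Y x v, z⟫ = 0 := by
  set u := extChartAt (𝓡 m) x x
  have hu : sphParam x u = x := sphParam_extChartAt x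
  have h1 := hasFDerivAt_comp_sphParam (F := Y) (x₀ := x) (u := u) (by rwa [hu])
  have h2 := h1.inner ℝ (hasFDerivAt_const z u)
  have hloc : IsLocalMax (fun v => ⟪Y (sphParam x v), z⟫) u := by
    refine Eventually.of_forall fun v => ?_
    have := hmax (sphParam x v)
    rw [inner_sub_left] at this
    simp only [hu]
    linarith
  have h3 := hloc.hasFDerivAt_eq_zero h2
  obtain ⟨w, hw⟩ := (isInvertible_sphParamDeriv x u).surjective v
  have h4 := DFunLike.congr_fun h3 w
  simp [fderivInnerCLM_apply, hw] at h4
  rw [hu] at h4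
  exact h4

namespace IsConvexHypersurface

variable (h : IsConvexHypersurface Y N)
include h

theorem mdifferentiableAt (x : Sph m) : MDifferentiableAt (𝓡 m) 𝓘(ℝ, Euc m) Y x :=
  h.smooth.mdifferentiableAt (by simp)

/-- Differentiability of the normal is hidden in strict convexity: without it the derivative takes
the default value `0`, and the second fundamental form would vanish on a nonzero vector, which
exists since `m ≥ 1`. -/
theorem mdifferentiableAt_normal (hm : 1 ≤ m) (x : Sph m) :
    MDifferentiableAt (𝓡 m) 𝓘(ℝ, Euc m) (fun z => (N z : Euc m)) x := by
  by_contra hN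
  have h1 := h.strict x (EuclideanSpace.single ⟨0, hm⟩ 1) (by simp)
  have h2 : diffAt (fun z => (N z : Euc m)) x = 0 := by
    rw [diffAt, mvfderiv, mfderiv_zero_of_not_mdifferentiableAt hN]
    exact ContinuousLinearMap.comp_zero _
  simp [h2] at h1

theorem supportFn_normal (x : Sph m) : supportFn (range Y) (N x) = ⟪Y x, (N x : Euc m)⟫ := by
  refine IsGreatest.csSup_eq ⟨⟨Y x, mem_range_self x, rfl⟩, ?_⟩
  rintro _ ⟨_, ⟨y, rfl⟩, rfl⟩
  have := h.outer x y
  rw [inner_sub_left] at this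
  simpa using this

theorem inner_le_supportFn (x z : Sph m) : ⟪Y x, (z : Euc m)⟫ ≤ supportFn (range Y) z := by
  refine le_csSup ?_ ⟨Y x, mem_range_self x, rfl⟩
  have : IsCompact ((fun y => ⟪y, (z : Euc m)⟫) '' range Y) :=
    (isCompact_range h.smooth.continuous).image (by fun_prop)
  exact this.bddAbove

/-- The outer unit normal is determined by the hypersurface. -/
theorem eq_normal (x z : Sph m) (hz : ∀ v, ⟪diffAt Y x v, (z : Euc m)⟫ = 0)
    (hz0 : 0 < ⟪Y x, (z : Euc m)⟫) (hN0 : 0 < ⟪Y x, (N x : Euc m)⟫) : z = N x := by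
  set K := LinearMap.range (diffAt Y x : EuclideanSpace ℝ (Fin m) →ₗ[ℝ] Euc m)
  have hK : Module.finrank ℝ K = m := by
    rw [LinearMap.finrank_range_of_inj (h.immersion x)]
    simp
  have hK' : Module.finrank ℝ Kᗮ = 1 := by
    have := Submodule.finrank_add_finrank_orthogonal K
    rw [hK, finrank_euclideanSpace_fin] at this
    omega
  have hmem : ∀ {w : Euc m}, (∀ v, ⟪diffAt Y x v, w⟫ = 0) → w ∈ Kᗮ := by
    intro w hw
    rw [Submodule.mem_orthogonal]
    rintro _ ⟨v, rfl⟩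
    exact hw v
  have hNne : (⟨(N x : Euc m), hmem (h.normal x)⟩ : Kᗮ) ≠ 0 := by
    intro h0
    have h1 : (N x : Euc m) = 0 := congrArg Subtype.val h0
    rw [h1, inner_zero_right] at hN0
    exact lt_irrefl _ hN0
  obtain ⟨k, hk⟩ := exists_smul_eq_of_finrank_eq_one hK' hNne ⟨(z : Euc m), hmem hz⟩
  have hk' : k • (N x : Euc m) = z := congrArg Subtype.val hk
  have hkpos : 0 < k := by
    rw [← hk', real_inner_smul_right] at hz0
    exact (pos_iff_pos_of_mul_pos hz0).2 hN0
  have hk1 : k = 1 := by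
    have := congrArg norm hk'
    rw [norm_smul, norm_eq_of_mem_sphere, norm_eq_of_mem_sphere, mul_one, Real.norm_eq_abs,
      abs_of_pos hkpos] at this
    exact this
  rw [hk1, one_smul] at hk'
  exact Subtype.ext hk'.symm

end IsConvexHypersurface

end Hypersurface

/-! ### Gauss curvature through the inverse Gauss map -/

section CoordMatrix

variable {k l n : ℕ}

/-- The matrix of a linear map between Euclidean spaces. -/
noncomputable def coordMatrix (L : EuclideanSpace ℝ (Fin k) →L[ℝ] EuclideanSpace ℝ (Fin l)) :
    Matrix (Fin l) (Fin k) ℝ :=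
  Matrix.of fun i j => L (EuclideanSpace.single j 1) i

theorem coordMatrix_mulVec (L : EuclideanSpace ℝ (Fin k) →L[ℝ] EuclideanSpace ℝ (Fin l))
    (v : EuclideanSpace ℝ (Fin k)) : coordMatrix L *ᵥ v = L v := by
  have hv : v = ∑ j, v j • EuclideanSpace.single j (1 : ℝ) := by
    ext i
    simp [Finset.sum_apply, Pi.single_apply]
  ext i
  conv_rhs => rw [hv]
  simp [mulVec, dotProduct, coordMatrix, mul_comm]

theorem coordMatrix_comp (L : EuclideanSpace ℝ (Fin l) →L[ℝ] EuclideanSpace ℝ (Fin n))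
    (L' : EuclideanSpace ℝ (Fin k) →L[ℝ] EuclideanSpace ℝ (Fin l)) :
    coordMatrix (L.comp L') = coordMatrix L * coordMatrix L' := by
  ext i j
  exact congrFun (coordMatrix_mulVec L (L' (EuclideanSpace.single j 1))).symm i

theorem dotProduct_eq_inner (v w : EuclideanSpace ℝ (Fin k)) :
    (v : Fin k → ℝ) ⬝ᵥ w = ⟪v, w⟫ := by
  rw [PiLp.inner_apply, dotProduct]
  exact Finset.sum_congr rfl fun i _ => mul_comm _ _

end CoordMatrix

namespace IsConvexHypersurface

variable {m : ℕ} {Y : Sph m → Euc m} {N : Sph m → Sph m}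

theorem inner_diffAt_normal (h : IsConvexHypersurface Y N) (hm : 1 ≤ m) (x : Sph m)
    (v : EuclideanSpace ℝ (Fin m)) :
    ⟪diffAt (fun z => (N z : Euc m)) x v, (N x : Euc m)⟫ = 0 := by
  set u := extChartAt (𝓡 m) x x
  have hu : sphParam x u = x := sphParam_extChartAt x
  have h1 := hasFDerivAt_comp_sphParam (F := fun z => (N z : Euc m)) (x₀ := x) (u := u)
    (h.mdifferentiableAt_normal hm _)
  have h2 := h1.inner ℝ h1
  have h3 : (fun v => ⟪(N (sphParam x v) : Euc m), (N (sphParam x v) : Euc m)⟫) = fun _ => 1 := by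
    ext v
    rw [real_inner_self_eq_norm_sq, norm_eq_of_mem_sphere, one_pow]
  rw [h3] at h2
  obtain ⟨w, hw⟩ := (isInvertible_sphParamDeriv x u).surjective v
  have h4 := DFunLike.congr_fun (h2.unique (hasFDerivAt_const _ _)) w
  simp [fderivInnerCLM_apply, hw, hu, real_inner_comm] at h4
  rwa [real_inner_comm]

/-- The Gauss curvature in terms of the inverse Gauss map `z ↦ Y (x(z))`, where `x(z)` is the point
with normal `z / |z|`. -/
theorem gaussCurvature_mul_det (h : IsConvexHypersurface Y N) (hm : 1 ≤ m) {y : Euc m}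
    (hy : ‖y‖ = 1) {x₀ : Sph m} {u : Euc m → EuclideanSpace ℝ (Fin m)}
    (hu : DifferentiableAt ℝ u y)
    (hN : ∀ᶠ z in 𝓝 y, (N (sphParam x₀ (u z)) : Euc m) = ‖z‖⁻¹ • z)
    {R : Matrix (Fin (m + 1)) (Fin (m + 1)) ℝ}
    (hR : ∀ i j, R i j =
      fderiv ℝ (fun z => Y (sphParam x₀ (u z))) y (EuclideanSpace.single i 1) j)
    (hsymm : Rᵀ = R) :
    (R + vecMulVec y y).PosDef ∧ R *ᵥ y = 0 ∧
      gaussCurvature Y N (sphParam x₀ (u y)) * (R + vecMulVec y y).det = 1 := by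
  set x := sphParam x₀ (u y) with hx
  set D := (sphParamDeriv x₀ (u y)).comp (fderiv ℝ u y) with hD
  set dY := diffAt Y x with hdY
  set dN := diffAt (fun z => (N z : Euc m)) x with hdN
  have hNx : (N x : Euc m) = y := by
    have := hN.self_of_nhds
    rwa [hy, inv_one, one_smul] at this
  have hY1 : HasFDerivAt (fun z => Y (sphParam x₀ (u z))) (dY.comp D) y :=
    (hasFDerivAt_comp_sphParam (h.mdifferentiableAt _)).comp y hu.hasFDerivAt
  have hN1 : HasFDerivAt (fun z => (N (sphParam x₀ (u z)) : Euc m)) (dN.comp D) y :=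
    (hasFDerivAt_comp_sphParam (F := fun z => (N z : Euc m))
      (h.mdifferentiableAt_normal hm _)).comp y hu.hasFDerivAt
  have hdNy : ∀ v, ⟪dN v, y⟫ = 0 := fun v => hNx ▸ h.inner_diffAt_normal hm x v
  have hdYy : ∀ v, ⟪dY v, y⟫ = 0 := fun v => hNx ▸ h.normal x v
  -- `dN ∘ D` is the derivative of `z / |z|` at a unit vector, i.e. the projection orthogonal to
  -- `y`. The coefficient of `y` is read off from `dN ⊥ y` instead of differentiating `‖z‖⁻¹`.
  have hND : ∀ w, dN (D w) = w - ⟪y, w⟫ • y := by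
    intro w
    have hy0 : y ≠ 0 := by
      rintro rfl
      simp at hy
    have hd : DifferentiableAt ℝ (fun z : Euc m => ‖z‖⁻¹) y :=
      (differentiableAt_id.norm ℝ hy0).inv (by simp [hy])
    have h1 := (hd.hasFDerivAt.smul (hasFDerivAt_id y)).congr_of_eventuallyEq hN
    have h2 := DFunLike.congr_fun (hN1.unique h1) w
    simp [hy] at h2
    have h3 := hdNy (D w)
    rw [h2, inner_add_left, real_inner_smul_left, real_inner_self_eq_norm_sq, hy, one_pow,
      mul_one, real_inner_comm] at h3
    rw [h2, show fderiv ℝ (fun z : Euc m => ‖z‖⁻¹) y w = -⟪y, w⟫ by linarith, neg_smul]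
    abel
  have hRmat : R = (coordMatrix dY * coordMatrix D)ᵀ := by
    rw [← coordMatrix_comp]
    ext i j
    rw [hR, hY1.fderiv]
    rfl
  have hRmat' : R = coordMatrix dY * coordMatrix D := by
    rw [← hsymm, hRmat, transpose_transpose]
  -- Since `dN (D y) = 0`, a nonzero `D y` would contradict strict convexity.
  have hDy : D y = 0 := by
    by_contra h0
    have := h.strict x _ h0
    rw [← hdN, hND, real_inner_self_eq_norm_sq, hy] at this
    simp at this
  have hRv : ∀ v : Euc m, R *ᵥ v = dY (D v) := fun v => by
    rw [hRmat', ← coordMatrix_comp, coordMatrix_mulVec]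
    rfl
  have hyy : (y : Fin (m + 1) → ℝ) ⬝ᵥ y = 1 := by
    rw [dotProduct_eq_inner, real_inner_self_eq_norm_sq, hy, one_pow]
  have hpos : (R + vecMulVec y y).PosDef := by
    refine .of_dotProduct_mulVec_pos ?_ fun a ha0 => ?_
    · rw [IsHermitian, conjTranspose_eq_transpose_of_trivial, transpose_add, hsymm,
        transpose_vecMulVec]
    · set w : Euc m := WithLp.toLp 2 a with hw
      have hwa : (w : Fin (m + 1) → ℝ) = a := rfl
      have hw0 : w ≠ 0 := fun h0 => ha0 (by rw [← hwa, h0]; rfl)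
      rw [star_trivial, ← hwa, add_mulVec, dotProduct_add, hRv, vecMulVec_mulVec]
      -- This turns the quadratic form of `R` into the second fundamental form at `D w`.
      have h1 : ⟪w, dY (D w)⟫ = ⟪dY (D w), dN (D w)⟫ := by
        rw [hND, inner_sub_right, real_inner_smul_right, hdYy, mul_zero, sub_zero, real_inner_comm]
      have h2 : (w : Fin (m + 1) → ℝ) ⬝ᵥ (MulOpposite.op ((y : Fin (m + 1) → ℝ) ⬝ᵥ w) • (y : Fin (m + 1) → ℝ)) =
          ⟪y, w⟫ ^ 2 := by
        rw [op_smul_eq_smul, dotProduct_smul, dotProduct_eq_inner, dotProduct_eq_inner, smul_eq_mul,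
          real_inner_comm w, sq]
      rw [h2, dotProduct_eq_inner, h1]
      by_cases hDw : D w = 0
      · have h3 := hND w
        rw [hDw, map_zero, eq_comm, sub_eq_zero] at h3
        have h4 : ⟪y, w⟫ ≠ 0 := fun h4 => hw0 (by rw [h3, h4, zero_smul])
        rw [hDw, map_zero, inner_zero_left, zero_add]
        positivity
      · exact add_pos_of_pos_of_nonneg (h.strict x _ hDw) (sq_nonneg _)
  refine ⟨hpos, by rw [hRv, hDy, map_zero]; rfl, ?_⟩
  have hfirst : firstForm Y x = (coordMatrix dY)ᵀ * coordMatrix dY := by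
    ext i j
    exact (dotProduct_eq_inner _ _).symm
  have hsecond : secondForm Y N x = (coordMatrix dY)ᵀ * coordMatrix dN := by
    ext i j
    exact (dotProduct_eq_inner _ _).symm
  have hdet := det_transpose_mul_self_eq (coordMatrix dY) (coordMatrix dN) (coordMatrix D) y
    (finSumFinEquiv.symm.trans (Equiv.sumCongr (Equiv.refl _) (Equiv.equivPUnit (Fin 1)))) hyy
    (by
      rw [← coordMatrix_comp]
      ext i j
      have := congrFun (congrArg WithLp.ofLp (hND (EuclideanSpace.single j 1))) i
      simp [coordMatrix, vecMulVec_apply, this, Matrix.one_apply, EuclideanSpace.inner_single_right,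
        mul_comm])
    (by
      ext j
      exact (dotProduct_eq_inner _ _).trans ((real_inner_comm _ _).trans (hdYy _)))
    (by
      ext j
      exact (dotProduct_eq_inner _ _).trans ((real_inner_comm _ _).trans (hdNy _)))
  have hfirst0 : (firstForm Y x).det ≠ 0 := by
    have hinj : Function.Injective (coordMatrix dY).mulVec := by
      intro a b hab
      have := h.immersion x (a₁ := WithLp.toLp 2 a) (a₂ := WithLp.toLp 2 b) (by
        apply WithLp.ofLp_injective
        rw [← hdY, ← coordMatrix_mulVec, ← coordMatrix_mulVec]
        exact hab)
      simpa using this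
    have := (Matrix.PosDef.conjTranspose_mul_self (coordMatrix dY) hinj).det_pos
    rw [conjTranspose_eq_transpose_of_trivial, ← hfirst] at this
    exact this.ne'
  rw [← hfirst, ← hsecond, ← hRmat'] at hdet
  rw [gaussCurvature, div_mul_eq_mul_div, ← hdet, div_self hfirst0]

end IsConvexHypersurface

/-! ### The flow in coordinates and its local inverse Gauss map -/

section Flow

variable {m : ℕ} {f g : Sph m → ℝ} {T : EReal} {X : Sph m → ℝ → Euc m} {ν : Sph m → ℝ → Sph m}

theorem coe_direction {y : Euc m} (hy : y ≠ 0) : (direction y : Euc m) = ‖y‖⁻¹ • y := by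
  simp [direction, hy]

theorem timeInterval_mem_nhds {t : ℝ} (ht : t ∈ timeInterval T) (h0 : 0 < t) :
    timeInterval T ∈ 𝓝 t := by
  have h1 : ∀ᶠ s : ℝ in 𝓝 t, (s : EReal) < T :=
    continuous_coe_real_ereal.continuousAt.eventually_lt_const ht.2
  filter_upwards [h1, lt_mem_nhds h0] with s hs hs0 using ⟨hs0.le, hs⟩

theorem uniqueDiffOn_timeInterval {t : ℝ} (ht : t ∈ timeInterval T) :
    UniqueDiffOn ℝ (timeInterval T) := by
  have hconv : Convex ℝ (timeInterval T) := by
    refine OrdConnected.convex ⟨fun a ha b hb s hs => ⟨ha.1.trans hs.1, ?_⟩⟩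
    exact (EReal.coe_le_coe_iff.2 hs.2).trans_lt hb.2
  refine uniqueDiffOn_convex hconv ?_
  obtain ⟨q, hq1, hq2⟩ := EReal.lt_iff_exists_real_btwn.1 ht.2
  have hq : t < q := EReal.coe_lt_coe_iff.1 hq1
  have hq0 : 0 < q := ht.1.trans_lt hq
  exact ⟨q, mem_interior_iff_mem_nhds.2 (timeInterval_mem_nhds ⟨hq0.le, hq2⟩ hq0)⟩

/-- The flow in the stereographic coordinates around `x₀`. -/
noncomputable def flowParam (X : Sph m → ℝ → Euc m) (x₀ : Sph m)
    (q : EuclideanSpace ℝ (Fin m) × ℝ) : Euc m := X (sphParam x₀ q.1) q.2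

/-- The normal speed of the flow. -/
noncomputable def normalSpeed (f g : Sph m → ℝ) (X : Sph m → ℝ → Euc m) (ν : Sph m → ℝ → Sph m)
    (x : Sph m) (t : ℝ) : ℝ :=
  f (ν x t) / g (direction (X x t)) * ‖X x t‖ ^ (m + 1) *
    gaussCurvature (fun y => X y t) (fun y => ν y t) x

namespace IsConvexFlow

variable (hF : IsConvexFlow f g T X ν)
include hF

theorem contDiffOn_flowParam (x₀ : Sph m) :
    ContDiffOn ℝ ∞ (flowParam X x₀) (univ ×ˢ timeInterval T) := by
  rw [← contMDiffOn_iff_contDiffOn]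
  have h1 : ContMDiff 𝓘(ℝ, EuclideanSpace ℝ (Fin m) × ℝ) (𝓡 m) ∞
      (fun q : EuclideanSpace ℝ (Fin m) × ℝ => sphParam x₀ q.1) :=
    (contMDiff_sphParam x₀).comp contDiff_fst.contMDiff
  have h2 : ContMDiff 𝓘(ℝ, EuclideanSpace ℝ (Fin m) × ℝ) 𝓘(ℝ, ℝ) ∞
      (fun q : EuclideanSpace ℝ (Fin m) × ℝ => q.2) := contDiff_snd.contMDiff
  exact hF.smooth.comp (h1.prodMk h2).contMDiffOn fun q hq => ⟨mem_univ _, hq.2⟩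

theorem contDiffAt_flowParam (x₀ : Sph m) {t : ℝ} (ht : timeInterval T ∈ 𝓝 t)
    (u : EuclideanSpace ℝ (Fin m)) : ContDiffAt ℝ ∞ (flowParam X x₀) (u, t) :=
  (hF.contDiffOn_flowParam x₀).contDiffAt (prod_mem_nhds univ_mem ht)

theorem fderiv_flowParam_space (x₀ : Sph m) {t : ℝ} (ht : timeInterval T ∈ 𝓝 t)
    (u v : EuclideanSpace ℝ (Fin m)) : fderiv ℝ (flowParam X x₀) (u, t) (v, 0) =
      diffAt (fun x => X x t) (sphParam x₀ u) (sphParamDeriv x₀ u v) := by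
  have h1 := ((hF.contDiffAt_flowParam x₀ ht u).differentiableAt (by simp)).hasFDerivAt
  have h2 : HasFDerivAt (fun u : EuclideanSpace ℝ (Fin m) => (u, t)) (.inl ℝ _ ℝ) u :=
    hasFDerivAt_prodMk_left u t
  have h3 := hasFDerivAt_comp_sphParam (x₀ := x₀) (u := u)
    ((hF.convex t (mem_of_mem_nhds ht)).mdifferentiableAt (sphParam x₀ u))
  have h4 := h1.comp u h2
  exact DFunLike.congr_fun (HasFDerivAt.unique (f := fun v => X (sphParam x₀ v) t) h4 h3) v

theorem fderiv_flowParam_time (x₀ : Sph m) {t : ℝ} (ht : timeInterval T ∈ 𝓝 t)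
    (u : EuclideanSpace ℝ (Fin m)) : fderiv ℝ (flowParam X x₀) (u, t) (0, 1) =
      -(normalSpeed f g X ν (sphParam x₀ u) t) • (ν (sphParam x₀ u) t : Euc m) +
        X (sphParam x₀ u) t := by
  have h1 := HasFDerivAt.hasDerivAt_time
    ((hF.contDiffAt_flowParam x₀ ht u).differentiableAt (by simp))
  exact h1.unique ((hF.flow (sphParam x₀ u) t (mem_of_mem_nhds ht)).hasDerivAt ht)

end IsConvexFlow

/-- `sphParam x₀ ∘ u` is a smooth local inverse of the Gauss maps, extended to be homogeneous of
degree zero. -/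
structure IsInverseGaussMap (T : EReal) (ν : Sph m → ℝ → Sph m) (x₀ : Sph m)
    (Ω : Set (Euc m × ℝ)) (u : Euc m × ℝ → EuclideanSpace ℝ (Fin m)) : Prop where
  isOpen : IsOpen Ω
  smooth : ContDiffOn ℝ ∞ u Ω
  time : ∀ p ∈ Ω, timeInterval T ∈ 𝓝 p.2
  ne_zero : ∀ p ∈ Ω, p.1 ≠ 0
  normal : ∀ p ∈ Ω, (ν (sphParam x₀ (u p)) p.2 : Euc m) = ‖p.1‖⁻¹ • p.1

theorem ContinuousLinearMap.isInvertible_of_injective_dual {E : Type*} [NormedAddCommGroup E]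
    [NormedSpace ℝ E] [FiniteDimensional ℝ E] (L : E →L[ℝ] E →L[ℝ] ℝ)
    (hL : ∀ w, (∀ v, L w v = 0) → w = 0) : L.IsInvertible := by
  have hinj : Function.Injective (L : E →ₗ[ℝ] E →L[ℝ] ℝ) := by
    refine (injective_iff_map_eq_zero _).2 fun w hw => hL w fun v => ?_
    exact DFunLike.congr_fun hw v
  have hdim : Module.finrank ℝ E = Module.finrank ℝ (E →L[ℝ] ℝ) := by
    rw [← (LinearMap.toContinuousLinearMap (𝕜 := ℝ) (E := E) (F' := ℝ)).finrank_eq]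
    exact Subspace.dual_finrank_eq.symm
  exact ⟨(LinearMap.linearEquivOfInjective _ hinj hdim).toContinuousLinearEquiv,
    ContinuousLinearMap.ext fun _ => rfl⟩

/-- No regularity of `ν` in time is assumed, so the equation `ν = y/|y|` is not solved directly.
Instead the implicit function theorem is applied to the orthogonality of `y` to the tangent space,
which involves only the smooth map `X`. -/
theorem IsConvexFlow.exists_isInverseGaussMap (hF : IsConvexFlow f g T X ν) (hm : 1 ≤ m)
    (hpos : ∀ t ∈ timeInterval T, ∀ x, 0 < ⟪X x t, (ν x t : Euc m)⟫) (x₀ : Sph m) {t₀ : ℝ}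
    (ht₀ : timeInterval T ∈ 𝓝 t₀) :
    ∃ Ω u, IsInverseGaussMap T ν x₀ Ω u ∧ ((ν x₀ t₀ : Euc m), t₀) ∈ Ω ∧
      sphParam x₀ (u ((ν x₀ t₀ : Euc m), t₀)) = x₀ := by
  set E := EuclideanSpace ℝ (Fin m)
  set u₀ : E := extChartAt (𝓡 m) x₀ x₀
  have hu₀ : sphParam x₀ u₀ = x₀ := sphParam_extChartAt x₀
  set y₀ : Euc m := (ν x₀ t₀ : Euc m) with hy₀
  set J := interior (timeInterval T)
  have hJ : ∀ {t}, t ∈ J → timeInterval T ∈ 𝓝 t := fun ht => mem_interior_iff_mem_nhds.1 ht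
  have hh := hF.convex t₀ (mem_of_mem_nhds ht₀)
  set F : (Euc m × ℝ) × E → (E →L[ℝ] ℝ) := fun z =>
    (innerSL ℝ z.1.1).comp ((fderiv ℝ (flowParam X x₀) (z.2, z.1.2)).comp (.inl ℝ E ℝ)) with hFdef
  have hFapp : ∀ z : (Euc m × ℝ) × E, z.1.2 ∈ J → ∀ v, F z v =
      ⟪z.1.1, diffAt (fun x => X x z.1.2) (sphParam x₀ z.2) (sphParamDeriv x₀ z.2 v)⟫ := by
    intro z hz v
    rw [← hF.fderiv_flowParam_space x₀ (hJ hz)]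
    rfl
  set V : Set ((Euc m × ℝ) × E) := {z | z.1.2 ∈ J}
  have hV : IsOpen V := isOpen_interior.preimage (by fun_prop)
  have hswap : ContDiff ℝ ∞ fun z : (Euc m × ℝ) × E => (z.2, z.1.2) := by fun_prop
  have hflow : ContDiffOn ℝ ∞ (flowParam X x₀) (univ ×ˢ J) :=
    (hF.contDiffOn_flowParam x₀).mono (prod_mono_right interior_subset)
  have hopen : IsOpen ((univ : Set E) ×ˢ J) := isOpen_univ.prod isOpen_interior
  have hXV : ContDiffOn ℝ ∞ (fun z : (Euc m × ℝ) × E => flowParam X x₀ (z.2, z.1.2)) V :=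
    hflow.comp hswap.contDiffOn fun z hz => ⟨mem_univ _, hz⟩
  have hFsmooth : ContDiffOn ℝ ∞ F V := by
    have h1 : ContDiffOn ℝ ∞ (fun z : (Euc m × ℝ) × E =>
        fderiv ℝ (flowParam X x₀) (z.2, z.1.2)) V :=
      (hflow.fderiv_of_isOpen hopen (m := ∞) (by simp)).comp hswap.contDiffOn
        fun z hz => ⟨mem_univ _, hz⟩
    have h2 : ContDiff ℝ ∞ fun z : (Euc m × ℝ) × E => innerSL ℝ z.1.1 :=
      (innerSL ℝ).contDiff.comp (by fun_prop)
    exact h2.contDiffOn.clm_comp (h1.clm_comp contDiffOn_const)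
  -- Orthogonality fixes the normal only up to sign; this open condition selects the outer one.
  set U : Set ((Euc m × ℝ) × E) :=
    V ∩ (fun z => ⟪flowParam X x₀ (z.2, z.1.2), z.1.1⟫) ⁻¹' Ioi 0 with hUdef
  have hU : IsOpen U := by
    refine ContinuousOn.isOpen_inter_preimage ?_ hV isOpen_Ioi
    exact hXV.continuousOn.inner (by fun_prop)
  have ht₀J : t₀ ∈ J := mem_interior_iff_mem_nhds.2 ht₀
  have hmem : ((y₀, t₀), u₀) ∈ U := by
    refine ⟨ht₀J, ?_⟩
    have := hpos t₀ (mem_of_mem_nhds ht₀) x₀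
    simpa only [mem_preimage, mem_Ioi, flowParam, hu₀] using this
  have hzero : F ((y₀, t₀), u₀) = 0 := by
    ext v
    rw [hFapp _ ht₀J]
    simp only [hu₀]
    rw [real_inner_comm]
    exact hh.normal _ _
  have hinv : (fderiv ℝ F ((y₀, t₀), u₀) ∘L .inr ℝ (Euc m × ℝ) E).IsInvertible := by
    refine ContinuousLinearMap.isInvertible_of_injective_dual _ fun w hw => ?_
    have h1 : HasFDerivAt (fun u => F ((y₀, t₀), u))
        (fderiv ℝ F ((y₀, t₀), u₀) ∘L .inr ℝ (Euc m × ℝ) E) u₀ :=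
      (hFsmooth.differentiableAt_of_isOpen hV ht₀J).hasFDerivAt.comp u₀
        (hasFDerivAt_prodMk_right _ _)
    set G : E → Euc m := fun u => fderiv ℝ (flowParam X x₀) (u, t₀) (w, 0) with hG
    have hGapp : ∀ u, G u = diffAt (fun x => X x t₀) (sphParam x₀ u) (sphParamDeriv x₀ u w) :=
      fun u => hF.fderiv_flowParam_space x₀ ht₀ u w
    have hGd : DifferentiableAt ℝ G u₀ := by
      have h2 : DifferentiableAt ℝ (fderiv ℝ (flowParam X x₀)) (u₀, t₀) :=
        (hflow.fderiv_of_isOpen hopen (m := ∞) (by simp)).differentiableAt_of_isOpen hopen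
          ⟨mem_univ _, ht₀J⟩
      have h3 : DifferentiableAt ℝ (fun u : E => (u, t₀)) u₀ := by fun_prop
      exact (h2.comp u₀ h3).clm_apply (differentiableAt_const _)
    have h2 : HasFDerivAt (fun u => F ((y₀, t₀), u) w)
        ((innerSL ℝ y₀).comp (fderiv ℝ G u₀)) u₀ :=
      (innerSL ℝ y₀).hasFDerivAt.comp u₀ hGd.hasFDerivAt
    have h3 : ⟪y₀, fderiv ℝ G u₀ w⟫ = 0 := by
      have h4 := (h1.clm_apply (hasFDerivAt_const w u₀)).unique h2
      have h5 := DFunLike.congr_fun h4 w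
      have h6 := hw w
      simp at h5 h6
      rw [← h5, h6]
    -- Differentiating `⟪ν, dX w⟫ = 0` along `w` and using `h3` kills the second derivative of `X`.
    -- What remains is the second fundamental form at `w`, so `w = 0` by strict convexity.
    have hN := hasFDerivAt_comp_sphParam (F := fun x => (ν x t₀ : Euc m)) (x₀ := x₀) (u := u₀)
      (hh.mdifferentiableAt_normal hm _)
    have h7 := hN.inner ℝ hGd.hasFDerivAt
    have h8 : (fun u => ⟪(ν (sphParam x₀ u) t₀ : Euc m), G u⟫) = fun _ => 0 := by
      ext u
      rw [hGapp, real_inner_comm]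
      exact hh.normal _ _
    rw [h8] at h7
    have h9 := DFunLike.congr_fun (h7.unique (hasFDerivAt_const _ _)) w
    simp only [ContinuousLinearMap.comp_apply, ContinuousLinearMap.prod_apply,
      fderivInnerCLM_apply, hGapp, hu₀, ← hy₀, h3, zero_add, _root_.zero_apply] at h9
    by_contra hw0
    have hw1 : sphParamDeriv x₀ u₀ w ≠ 0 := fun h0 =>
      hw0 ((isInvertible_sphParamDeriv x₀ u₀).injective (h0.trans (map_zero _).symm))
    have := hh.strict x₀ _ hw1
    rw [real_inner_comm, h9] at this
    exact lt_irrefl _ this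
  obtain ⟨Ω, ψ, hΩ, hpΩ, hψ, hψp, hΩU⟩ :=
    exists_contDiffOn_implicit hU (hFsmooth.mono inter_subset_left) hmem hzero hinv
  refine ⟨Ω, ψ, ⟨hΩ, hψ, fun p hp => hJ (hΩU p hp).1.1, fun p hp => ?_, fun p hp => ?_⟩, hpΩ,
    by rw [hψp, hu₀]⟩
  · rintro h0
    have := (hΩU p hp).1.2
    simp [h0] at this
  · obtain ⟨⟨hpJ, hp1⟩, hp2⟩ := hΩU p hp
    have hp0 : p.1 ≠ 0 := by
      rintro h0
      simp [h0] at hp1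
    have hpT := mem_of_mem_nhds (hJ hpJ)
    have hp1' : 0 < ⟪X (sphParam x₀ (ψ p)) p.2, p.1⟫ := hp1
    rw [← coe_direction hp0]
    congr 1
    refine ((hF.convex p.2 hpT).eq_normal _ (direction p.1) (fun v => ?_) ?_
      (hpos p.2 hpT _)).symm
    · obtain ⟨w, rfl⟩ := (isInvertible_sphParamDeriv x₀ (ψ p)).surjective v
      have h1 := hFapp (p, ψ p) hpJ w
      rw [hp2] at h1
      rw [coe_direction hp0, real_inner_smul_right, real_inner_comm]
      exact mul_eq_zero_of_right _ h1.symm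
    · rw [coe_direction hp0, real_inner_smul_right]
      exact mul_pos (inv_pos.2 (norm_pos_iff.2 hp0)) hp1'

end Flow

/-! ### The support function near a point, and its derivatives -/

section LocalSupport

variable {m : ℕ} {f g : Sph m → ℝ} {T : EReal} {X : Sph m → ℝ → Euc m} {ν : Sph m → ℝ → Sph m}
  {x₀ : Sph m} {Ω : Set (Euc m × ℝ)} {u : Euc m × ℝ → EuclideanSpace ℝ (Fin m)}

/-- The point of the hypersurface with normal `p.1 / |p.1|` at time `p.2`. -/
noncomputable def normalPoint (X : Sph m → ℝ → Euc m) (x₀ : Sph m)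
    (u : Euc m × ℝ → EuclideanSpace ℝ (Fin m)) (p : Euc m × ℝ) : Euc m :=
  X (sphParam x₀ (u p)) p.2

/-- The support function, extended to be homogeneous of degree one. -/
noncomputable def localSupport (X : Sph m → ℝ → Euc m) (x₀ : Sph m)
    (u : Euc m × ℝ → EuclideanSpace ℝ (Fin m)) (p : Euc m × ℝ) : ℝ :=
  ⟪normalPoint X x₀ u p, p.1⟫

namespace IsInverseGaussMap

variable (hG : IsInverseGaussMap T ν x₀ Ω u)
include hG

theorem smul_normal {p : Euc m × ℝ} (hp : p ∈ Ω) :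
    ‖p.1‖ • (ν (sphParam x₀ (u p)) p.2 : Euc m) = p.1 := by
  rw [hG.normal p hp, smul_smul, mul_inv_cancel₀ (norm_ne_zero_iff.2 (hG.ne_zero p hp)), one_smul]

variable (hF : IsConvexFlow f g T X ν)
include hF

theorem contDiffOn_normalPoint : ContDiffOn ℝ ∞ (normalPoint X x₀ u) Ω :=
  ContDiffOn.comp (g := flowParam X x₀) (f := fun p => (u p, p.2)) (hF.contDiffOn_flowParam x₀)
    (hG.smooth.prodMk contDiffOn_snd) fun p hp => ⟨mem_univ _, mem_of_mem_nhds (hG.time p hp)⟩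

theorem contDiffOn_localSupport : ContDiffOn ℝ ∞ (localSupport X x₀ u) Ω :=
  (hG.contDiffOn_normalPoint hF).inner ℝ contDiffOn_fst

/-- Moving the parameter `u` only moves the point tangentially, so just the explicit time
derivative, given by the flow, has a normal component. Consequently the spatial gradient of the
support function is the point itself. -/
theorem inner_fderiv_normalPoint {p : Euc m × ℝ} (hp : p ∈ Ω) (w : Euc m) (s : ℝ) :
    ⟪fderiv ℝ (normalPoint X x₀ u) p (w, s), p.1⟫ =
      s * (localSupport X x₀ u p - ‖p.1‖ * normalSpeed f g X ν (sphParam x₀ (u p)) p.2) := by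
  have ht := hG.time p hp
  have hu := (hG.smooth.differentiableAt_of_isOpen hG.isOpen hp).hasFDerivAt
  have h1 := ((hF.contDiffAt_flowParam x₀ ht (u p)).differentiableAt (by simp)).hasFDerivAt
  have h2 : HasFDerivAt (fun q : Euc m × ℝ => (u q, q.2)) _ p := hu.prodMk hasFDerivAt_snd
  have h3 : fderiv ℝ (normalPoint X x₀ u) p (w, s) = fderiv ℝ (flowParam X x₀) (u p, p.2)
      (fderiv ℝ u p (w, s), s) := by
    have h4 := h1.comp p h2
    rw [HasFDerivAt.fderiv (f := normalPoint X x₀ u) h4]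
    rfl
  have h5 : ((fderiv ℝ u p (w, s), s) : EuclideanSpace ℝ (Fin m) × ℝ) =
      (fderiv ℝ u p (w, s), 0) + s • (0, 1) := by simp
  have h6 := (hF.convex p.2 (mem_of_mem_nhds ht)).normal (sphParam x₀ (u p))
    (sphParamDeriv x₀ (u p) (fderiv ℝ u p (w, s)))
  have h7 : ∀ z : Euc m, ⟪z, p.1⟫ = ‖p.1‖ * ⟪z, (ν (sphParam x₀ (u p)) p.2 : Euc m)⟫ := by
    intro z
    conv_lhs => rw [← hG.smul_normal hp]
    rw [real_inner_smul_right]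
  rw [h3, h5, map_add, map_smul, hF.fderiv_flowParam_space x₀ ht, hF.fderiv_flowParam_time x₀ ht,
    h7, inner_add_left, h6, localSupport, h7, real_inner_smul_left, inner_add_left,
    real_inner_smul_left, real_inner_self_eq_norm_sq, norm_eq_of_mem_sphere, normalPoint]
  ring

theorem dirDeriv_localSupport {p : Euc m × ℝ} (hp : p ∈ Ω) (w : Euc m) (s : ℝ) :
    dirDeriv (w, s) (localSupport X x₀ u) p = ⟪normalPoint X x₀ u p, w⟫ +
      s * (localSupport X x₀ u p - ‖p.1‖ * normalSpeed f g X ν (sphParam x₀ (u p)) p.2) := by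
  have h1 := ((hG.contDiffOn_normalPoint hF).differentiableAt_of_isOpen hG.isOpen hp).hasFDerivAt
  have h2 : HasFDerivAt (localSupport X x₀ u) _ p := h1.inner ℝ hasFDerivAt_fst
  rw [h2.dirDeriv_eq, ← hG.inner_fderiv_normalPoint hF hp w s]
  simp [fderivInnerCLM_apply]

theorem dirDeriv_localSupport_space {p : Euc m × ℝ} (hp : p ∈ Ω) (w : Euc m) :
    dirDeriv (w, 0) (localSupport X x₀ u) p = ⟪normalPoint X x₀ u p, w⟫ := by
  rw [hG.dirDeriv_localSupport hF hp, zero_mul, add_zero]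

theorem supportSpeed_localSupport {p : Euc m × ℝ} (hp : p ∈ Ω) :
    supportSpeed (localSupport X x₀ u) p =
      ‖p.1‖ * normalSpeed f g X ν (sphParam x₀ (u p)) p.2 := by
  rw [supportSpeed, hG.dirDeriv_localSupport hF hp, inner_zero_right]
  ring

theorem spatialHessian_localSupport {y : Euc m} {t : ℝ} (hp : (y, t) ∈ Ω) (i j : Fin (m + 1)) :
    spatialHessian (localSupport X x₀ u) (y, t) i j =
      fderiv ℝ (fun z => X (sphParam x₀ (u (z, t))) t) y (EuclideanSpace.single i 1) j := by
  have h1 := ((hG.contDiffOn_normalPoint hF).differentiableAt_of_isOpen hG.isOpen hp).hasFDerivAt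
  have hl : HasFDerivAt (fun z : Euc m => (z, t)) (.inl ℝ (Euc m) ℝ) y :=
    hasFDerivAt_prodMk_left y t
  have h2 := h1.comp y hl
  rw [HasFDerivAt.fderiv (f := fun z => X (sphParam x₀ (u (z, t))) t) h2, spatialHessian,
    Matrix.of_apply, dirDeriv_congr hG.isOpen
      (fun q hq => hG.dirDeriv_localSupport_space hF hq (EuclideanSpace.single j 1)) hp,
    HasFDerivAt.dirDeriv_eq (h1.inner ℝ (hasFDerivAt_const _ _))]
  simp [fderivInnerCLM_apply, EuclideanSpace.inner_single_right]

theorem hessian_curvature (hm : 1 ≤ m) {y : Euc m} {t : ℝ} (hp : (y, t) ∈ Ω) (hy : ‖y‖ = 1) :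
    (spatialHessian (localSupport X x₀ u) (y, t) + vecMulVec y y).PosDef ∧
      spatialHessian (localSupport X x₀ u) (y, t) *ᵥ y = 0 ∧
      gaussCurvature (fun x => X x t) (fun x => ν x t) (sphParam x₀ (u (y, t))) *
        (spatialHessian (localSupport X x₀ u) (y, t) + vecMulVec y y).det = 1 := by
  have hcont : Continuous fun z : Euc m => (z, t) := by fun_prop
  refine (hF.convex t (mem_of_mem_nhds (hG.time _ hp))).gaussCurvature_mul_det hm hy
    (u := fun z => u (z, t)) ?_ ?_ (fun i j => hG.spatialHessian_localSupport hF hp i j) ?_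
  · exact (hG.smooth.differentiableAt_of_isOpen hG.isOpen hp).comp y
      (hasFDerivAt_prodMk_left y t).differentiableAt
  · filter_upwards [hcont.continuousAt.eventually_mem (hG.isOpen.mem_nhds hp)] with z hz
      using hG.normal _ hz
  · ext i j
    exact dirDeriv_comm (hG.contDiffOn_localSupport hF) hG.isOpen hp

end IsInverseGaussMap

end LocalSupport

/-! ### The radial factor along a curve -/

section Radial

variable {m : ℕ}

theorem mdifferentiableAt_direction {q : Euc m} (hq : q ≠ 0) :
    MDifferentiableAt 𝓘(ℝ, Euc m) (𝓡 m) (direction : Euc m → Sph m) q := by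
  have hne : ∀ᶠ z in 𝓝 q, z ≠ 0 := isOpen_ne.mem_nhds hq
  have hcoe : (fun z => (direction z : Euc m)) =ᶠ[𝓝 q] fun z => ‖z‖⁻¹ • z := by
    filter_upwards [hne] with z hz using coe_direction hz
  have hd : DifferentiableAt ℝ (fun z => (direction z : Euc m)) q := by
    refine DifferentiableAt.congr_of_eventuallyEq ?_ hcoe
    exact ((differentiableAt_id.norm ℝ hq).inv (norm_ne_zero_iff.2 hq)).smul differentiableAt_id
  rw [mdifferentiableAt_iff_target]
  refine ⟨Topology.IsInducing.subtypeVal.continuousAt_iff.2 hd.continuousAt, ?_⟩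
  rw [mdifferentiableAt_iff_differentiableAt]
  -- The chart at a point of the sphere projects stereographically from the antipode.
  set v : Sph m := -direction q with hv
  let U := (OrthonormalBasis.fromOrthogonalSpanSingleton (𝕜 := ℝ) m
    (ne_zero_of_mem_unit_sphere v)).repr
  have hst : DifferentiableAt ℝ (stereoToFun (v : Euc m)) (direction q : Euc m) := by
    refine (contDiffOn_stereoToFun (n := ∞)).differentiableOn (by simp) |>.differentiableAt ?_
    refine IsOpen.mem_nhds ?_ ?_
    · exact isOpen_ne.preimage (innerSL ℝ (v : Euc m)).continuous
    · simp [hv]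
      norm_num
  have h : DifferentiableAt ℝ (fun z => U (stereoToFun (v : Euc m) (direction z : Euc m))) q :=
    U.differentiable.differentiableAt.comp q
      (DifferentiableAt.comp (f := fun z => (direction z : Euc m)) q hst hd)
  exact h

/-- The factor `2` comes from the triangle inequality for the derivative of `‖q‖⁻¹ • q`, in place of
the sharp factor `1` of the tangential projection. -/
theorem hasDerivAt_comp_direction {g : Sph m → ℝ} {L : ℝ} (hg : ContMDiff (𝓡 m) 𝓘(ℝ, ℝ) ∞ g)
    (hL : GradBound g L) {q : ℝ → Euc m} {q' : Euc m} {t : ℝ} (hq : HasDerivAt q q' t)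
    (hq0 : q t ≠ 0) : ∃ d, HasDerivAt (fun s => g (direction (q s))) d t ∧
      |d| ≤ |L| * (2 * (‖q'‖ / ‖q t‖)) := by
  have hγ : MDifferentiableAt 𝓘(ℝ, ℝ) (𝓡 m) (fun s => direction (q s)) t :=
    (mdifferentiableAt_direction hq0).comp t hq.differentiableAt.mdifferentiableAt
  set Γ : ℝ →L[ℝ] EuclideanSpace ℝ (Fin m) :=
    mfderiv 𝓘(ℝ, ℝ) (𝓡 m) (fun s => direction (q s)) t
  set dg : EuclideanSpace ℝ (Fin m) →L[ℝ] ℝ := mvfderiv (𝓡 m) g (direction (q t)) with hdg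
  have h1 : HasFDerivAt (fun s => g (direction (q s))) (dg.comp Γ) t :=
    ((hg.mdifferentiableAt (by simp)).hasMFDerivAt.comp t hγ.hasMFDerivAt).hasFDerivAt
  have h2 : HasFDerivAt (fun s => (direction (q s) : Euc m))
      ((diffAt (fun z : Sph m => (z : Euc m)) (direction (q t))).comp Γ) t :=
    (((contMDiff_coe_sphere (m := ∞)).mdifferentiableAt (by simp)).hasMFDerivAt.comp t
      hγ.hasMFDerivAt).hasFDerivAt
  refine ⟨_, h1.hasDerivAt, (hL _ (Γ 1)).trans ?_⟩
  refine mul_le_mul (le_abs_self L) ?_ (norm_nonneg _) (abs_nonneg L)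
  have hn0 : ‖q t‖ ≠ 0 := norm_ne_zero_iff.2 hq0
  have hn : HasDerivAt (fun s => ‖q s‖) (fderiv ℝ (norm : Euc m → ℝ) (q t) q') t :=
    ((differentiableAt_id.norm ℝ hq0).hasFDerivAt (x := q t)).comp_hasDerivAt t hq
  set n' := fderiv ℝ (norm : Euc m → ℝ) (q t) q'
  have hn' : |n'| ≤ ‖q'‖ := by
    have h3 : ‖fderiv ℝ (norm : Euc m → ℝ) (q t)‖ ≤ 1 := by
      simpa using norm_fderiv_le_of_lipschitz ℝ (lipschitzWith_one_norm (E := Euc m)) (x₀ := q t)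
    simpa using (fderiv ℝ (norm : Euc m → ℝ) (q t)).le_of_opNorm_le h3 q'
  have h3 := (hn.fun_inv hn0).smul hq
  have hcoe : (fun s => (direction (q s) : Euc m)) =ᶠ[𝓝 t] fun s => ‖q s‖⁻¹ • q s := by
    filter_upwards [hq.continuousAt.eventually_ne hq0] with s hs using coe_direction hs
  have h6 : diffAt (fun z : Sph m => (z : Euc m)) (direction (q t)) (Γ 1) = _ :=
    h2.hasDerivAt.unique (h3.congr_of_eventuallyEq hcoe)
  rw [h6]
  have hnpos : 0 < ‖q t‖ := norm_pos_iff.2 hq0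
  refine (norm_add_le _ _).trans ?_
  rw [norm_smul, norm_smul, norm_inv, norm_norm, norm_div, norm_neg, norm_pow, norm_norm,
    Real.norm_eq_abs]
  have h4 : |n'| / ‖q t‖ ^ 2 * ‖q t‖ ≤ ‖q'‖ / ‖q t‖ := by
    rw [sq, ← div_div, div_mul_cancel₀ _ hn0]
    gcongr
  have h5 : ‖q t‖⁻¹ * ‖q'‖ = ‖q'‖ / ‖q t‖ := by rw [div_eq_inv_mul]
  linarith

/-- Logarithmic derivative of the factor `|q|ᵏ / g(q / |q|)` along a curve. -/
theorem hasDerivAt_radial {g : Sph m → ℝ} {L a : ℝ} (hg : ContMDiff (𝓡 m) 𝓘(ℝ, ℝ) ∞ g)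
    (hL : GradBound g L) (ha : 0 < a) (hga : ∀ x, a ≤ g x) {q : ℝ → Euc m} {q' : Euc m} {t : ℝ}
    (hq : HasDerivAt q q' t) (hq0 : q t ≠ 0) {b : ℝ} (hb : b ≠ 0) (k : ℕ) :
    ∃ d, HasDerivAt (fun s => b / g (direction (q s)) * ‖q s‖ ^ k) d t ∧
      d / (b / g (direction (q t)) * ‖q t‖ ^ k) ≤ (k + 2 * |L| / a) * (‖q'‖ / ‖q t‖) := by
  obtain ⟨e, he, hebound⟩ := hasDerivAt_comp_direction hg hL hq hq0
  have hn0 : ‖q t‖ ≠ 0 := norm_ne_zero_iff.2 hq0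
  have hnpos : 0 < ‖q t‖ := norm_pos_iff.2 hq0
  have hgpos : 0 < g (direction (q t)) := ha.trans_le (hga _)
  have hn : HasDerivAt (fun s => ‖q s‖) (fderiv ℝ (norm : Euc m → ℝ) (q t) q') t :=
    ((differentiableAt_id.norm ℝ hq0).hasFDerivAt (x := q t)).comp_hasDerivAt t hq
  set n' := fderiv ℝ (norm : Euc m → ℝ) (q t) q'
  have hn' : |n'| ≤ ‖q'‖ := by
    have h3 : ‖fderiv ℝ (norm : Euc m → ℝ) (q t)‖ ≤ 1 := by
      simpa using norm_fderiv_le_of_lipschitz ℝ (lipschitzWith_one_norm (E := Euc m)) (x₀ := q t)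
    simpa using (fderiv ℝ (norm : Euc m → ℝ) (q t)).le_of_opNorm_le h3 q'
  have h1 := ((hasDerivAt_const t b).fun_div he hgpos.ne').fun_mul (hn.fun_pow k)
  refine ⟨_, h1, ?_⟩
  set G := g (direction (q t))
  set r := ‖q t‖
  -- The case `k = 0` is separate because of the truncated exponent `k - 1`.
  have hratio : ((0 * G - b * e) / G ^ 2 * r ^ k + b / G * (k * r ^ (k - 1) * n')) /
      (b / G * r ^ k) = k * (n' / r) - e / G := by
    rcases k with _ | k
    · field_simp
      simp
      ring
    · simp only [Nat.add_sub_cancel]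
      field_simp
      ring
  rw [hratio]
  have h2 : n' / r ≤ ‖q'‖ / r := by
    gcongr
    exact (le_abs_self _).trans hn'
  have h3 : -(e / G) ≤ |L| * (2 * (‖q'‖ / r)) / a := by
    calc -(e / G) ≤ |e| / G := by
          rw [← neg_div]
          gcongr
          exact neg_le_abs e
      _ ≤ |L| * (2 * (‖q'‖ / r)) / a := by
          gcongr
          exact hga _
  have h4 : (k : ℝ) * (n' / r) ≤ k * (‖q'‖ / r) := by gcongr
  have h5 : |L| * (2 * (‖q'‖ / r)) / a = 2 * |L| / a * (‖q'‖ / r) := by ring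
  rw [add_mul]
  linarith

end Radial

/-! ### Curvature at a maximum, and continuity of the speed -/

namespace IsConvexFlow

variable {m : ℕ} {f g : Sph m → ℝ} {T : EReal} {X : Sph m → ℝ → Euc m} {ν : Sph m → ℝ → Sph m}
  (hF : IsConvexFlow f g T X ν)
include hF

/-- At an interior maximum of `normalSpeed / (⟪X, ν⟫ - ε)` the curvature is bounded. -/
theorem gaussCurvature_le_of_max (hm : 1 ≤ m) {a L ε M : ℝ}
    (hg : ContMDiff (𝓡 m) 𝓘(ℝ, ℝ) ∞ g) (hL : GradBound g L) (ha : 0 < a) (hfa : ∀ x, a ≤ f x)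
    (hga : ∀ x, a ≤ g x) (hε : 0 < ε) (hM : 1 ≤ M)
    (hlow : ∀ t ∈ timeInterval T, ∀ x, 2 * ε ≤ ⟪X x t, (ν x t : Euc m)⟫) {x₀ : Sph m} {t₀ : ℝ}
    (ht₀ : timeInterval T ∈ 𝓝 t₀)
    (hmax : ∀ t ∈ timeInterval T, t ≤ t₀ → ∀ x,
      normalSpeed f g X ν x t ≤ M * (⟪X x t, (ν x t : Euc m)⟫ - ε))
    (heq : normalSpeed f g X ν x₀ t₀ = M * (⟪X x₀ t₀, (ν x₀ t₀ : Euc m)⟫ - ε)) :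
    gaussCurvature (fun y => X y t₀) (fun y => ν y t₀) x₀ ≤
      ((m + 1 + 4 * ε + (m + 1 + 2 * |L| / a) * (5 / 2)) / ε) ^ (m + 1) := by
  have hpos : ∀ t ∈ timeInterval T, ∀ x, 0 < ⟪X x t, (ν x t : Euc m)⟫ := fun t ht x =>
    (by positivity : 0 < 2 * ε).trans_le (hlow t ht x)
  obtain ⟨Ω, u, hG, hmem, hux⟩ := hF.exists_isInverseGaussMap hm hpos x₀ ht₀
  set y : Euc m := (ν x₀ t₀ : Euc m) with hyν
  have hy : ‖y‖ = 1 := norm_eq_of_mem_sphere _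
  have hM0 : 0 < M := one_pos.trans_le hM
  set H := localSupport X x₀ u
  set P := normalPoint X x₀ u
  have hPsmooth := hG.contDiffOn_normalPoint hF
  have hHsmooth := hG.contDiffOn_localSupport hF
  have hP0 : P (y, t₀) = X x₀ t₀ := by simp only [P, normalPoint, hux]
  have hH0 : H (y, t₀) = ⟪X x₀ t₀, y⟫ := by
    change ⟪P (y, t₀), y⟫ = _
    rw [hP0]
  have hlow0 : 2 * ε ≤ H (y, t₀) := by
    rw [hH0]
    exact hlow t₀ (mem_of_mem_nhds ht₀) x₀
  have hbound : ∀ p ∈ Ω, p.2 ≤ t₀ → supportSpeed H p ≤ M * (H p - ε * ‖p.1‖) := by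
    intro p hp hpt
    rw [hG.supportSpeed_localSupport hF hp]
    have h1 := hmax p.2 (mem_of_mem_nhds (hG.time p hp)) hpt (sphParam x₀ (u p))
    have h2 : H p = ‖p.1‖ * ⟪X (sphParam x₀ (u p)) p.2, (ν (sphParam x₀ (u p)) p.2 : Euc m)⟫ := by
      change ⟪P p, p.1⟫ = _
      conv_lhs => rw [← hG.smul_normal hp]
      rw [real_inner_smul_right]
      rfl
    rw [h2]
    nlinarith [mul_le_mul_of_nonneg_left h1 (norm_nonneg p.1)]
  have heq' : supportSpeed H (y, t₀) = M * (H (y, t₀) - ε) := by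
    rw [hG.supportSpeed_localSupport hF hmem, hH0, hy, one_mul, hux, heq]
  have hspace : ∀ᶠ z in 𝓝 y, supportSpeed H (z, t₀) ≤ M * (H (z, t₀) - ε * ‖z‖) := by
    have hcont : Continuous fun z : Euc m => (z, t₀) := by fun_prop
    filter_upwards [hcont.continuousAt.eventually_mem (hG.isOpen.mem_nhds hmem)] with z hz
      using hbound _ hz le_rfl
  have hmemt : ∀ᶠ t in 𝓝 t₀, (y, t) ∈ Ω := by
    have hcont : Continuous fun t : ℝ => (y, t) := by fun_prop
    exact hcont.continuousAt.eventually_mem (hG.isOpen.mem_nhds hmem)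
  have htime : ∀ᶠ t in 𝓝[<] t₀, supportSpeed H (y, t) ≤ M * (H (y, t) - ε) := by
    filter_upwards [hmemt.filter_mono nhdsWithin_le_nhds, self_mem_nhdsWithin] with t ht hlt
    simpa only [hy, mul_one] using hbound _ ht (le_of_lt hlt)
  obtain ⟨hApos, hker, hdet⟩ := hG.hessian_curvature hF hm hmem hy
  have hPd := hPsmooth.differentiableAt_of_isOpen hG.isOpen hmem
  have hPt := hasDerivAt_gradient hG.isOpen hHsmooth
    (fun p hp w => hG.dirDeriv_localSupport_space hF hp w) hmem hPd hy hM0.le hε.le heq' hspace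
  have hPnorm : 2 * ε ≤ ‖P (y, t₀)‖ := by
    refine hlow0.trans ((real_inner_le_norm _ _).trans ?_)
    simp [hy, P]
  have hPpos : 0 < ‖P (y, t₀)‖ := (by positivity : 0 < 2 * ε).trans_le hPnorm
  have hfpos : 0 < f (ν x₀ t₀) := ha.trans_le (hfa _)
  obtain ⟨d, hd, hdle⟩ := hasDerivAt_radial hg hL ha hga hPt (norm_pos_iff.1 hPpos) hfpos.ne' (m + 1)
  -- At fixed `y` the normal, hence the value of `f`, does not change with time.
  have hspeed : ∀ᶠ t in 𝓝 t₀,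
      supportSpeed H (y, t) * (spatialHessian H (y, t) + vecMulVec y y).det =
        f (ν x₀ t₀) / g (direction (P (y, t))) * ‖P (y, t)‖ ^ (m + 1) := by
    filter_upwards [hmemt] with t ht
    have hν : ν (sphParam x₀ (u (y, t))) t = ν x₀ t₀ := by
      refine Subtype.ext ?_
      rw [hG.normal _ ht, hy, inv_one, one_smul]
    rw [hG.supportSpeed_localSupport hF ht, hy, one_mul, normalSpeed, hν, mul_assoc,
      (hG.hessian_curvature hF hm ht hy).2.2, mul_one]
    rfl
  have hest := trace_inv_le_of_max hG.isOpen hHsmooth hmem hy hM0 hε.le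
    (by linarith) (by linarith) heq' hspace htime hApos hker hd hspeed
  set A := spatialHessian H (y, t₀) + vecMulVec y y
  rw [hux] at hdet
  -- The velocity is at most `|P| + M (|P| + ε)`; `M ≥ 1` and `ε ≤ |P|/2` give the factor `1 + 1 +
  -- 1/2`.
  have hvel : ‖P (y, t₀) - M • (P (y, t₀) - ε • y)‖ / ‖P (y, t₀)‖ ≤ 5 / 2 * M := by
    rw [div_le_iff₀ hPpos]
    calc ‖P (y, t₀) - M • (P (y, t₀) - ε • y)‖
        ≤ ‖P (y, t₀)‖ + ‖M • (P (y, t₀) - ε • y)‖ := norm_sub_le _ _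
      _ ≤ ‖P (y, t₀)‖ + M * (‖P (y, t₀)‖ + ε) := by
          rw [norm_smul, Real.norm_of_nonneg hM0.le]
          have : ‖P (y, t₀) - ε • y‖ ≤ ‖P (y, t₀)‖ + ε := by
            refine (norm_sub_le _ _).trans_eq ?_
            rw [norm_smul, hy, mul_one, Real.norm_of_nonneg hε.le]
          gcongr
      _ ≤ 5 / 2 * M * ‖P (y, t₀)‖ := by nlinarith
  set c₁ : ℝ := m + 1 + 2 * |L| / a with hc₁
  have hc₁0 : 0 ≤ c₁ := by positivity
  set κ : ℝ := m + 1 + 4 * ε + c₁ * (5 / 2) with hκ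
  have htr : A⁻¹.trace ≤ κ / ε := by
    rw [le_div_iff₀ hε]
    have h1 : d / (f (ν x₀ t₀) / g (direction (P (y, t₀))) * ‖P (y, t₀)‖ ^ (m + 1)) ≤
        c₁ * (5 / 2 * M) := by
      refine hdle.trans ?_
      push_cast
      gcongr
    have h2 : M * (A⁻¹.trace * ε) ≤ M * κ := by
      rw [hκ]
      linarith
    exact le_of_mul_le_mul_left h2 hM0
  have hAinv := hApos.inv
  have hK : gaussCurvature (fun y => X y t₀) (fun y => ν y t₀) x₀ = A⁻¹.det := by
    rw [det_nonsing_inv, Ring.inverse_eq_inv']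
    exact eq_inv_of_mul_eq_one_left hdet
  rw [hK]
  refine hAinv.posSemidef.det_le_trace_pow.trans ?_
  rw [Fintype.card_fin]
  exact pow_le_pow_left₀ hAinv.posSemidef.trace_nonneg htr _

/-- By compactness of the sphere it suffices to identify cluster points of `ν`. The inequality for
outer normals and the lower bound `δ` pass to the limit, and the outer unit normal at a point is
unique. -/
theorem continuousOn_normal (hpos : ∃ δ > 0, ∀ t ∈ timeInterval T, ∀ x,
      δ ≤ ⟪X x t, (ν x t : Euc m)⟫) :
    ContinuousOn (fun p : Sph m × ℝ => ν p.1 p.2) (univ ×ˢ timeInterval T) := by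
  obtain ⟨δ, hδ, hpos⟩ := hpos
  rintro ⟨x, t⟩ ⟨-, ht⟩
  have hX := hF.smooth.continuousOn
  have hh := hF.convex t ht
  refine isCompact_univ.tendsto_nhds_of_unique_mapClusterPt (by simp) fun z _ hz => ?_
  obtain ⟨U, hU, hUz⟩ := mapClusterPt_iff_ultrafilter.1 hz
  have hUz' : Tendsto (fun p : Sph m × ℝ => (ν p.1 p.2 : Euc m)) U (𝓝 (z : Euc m)) :=
    (continuous_subtype_val.tendsto z).comp hUz
  have hmem : ∀ᶠ p : Sph m × ℝ in U, p ∈ univ ×ˢ timeInterval T := hU self_mem_nhdsWithin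
  have hXU : Tendsto (fun p : Sph m × ℝ => X p.1 p.2) U (𝓝 (X x t)) :=
    (hX (x, t) ⟨mem_univ _, ht⟩).mono_left hU
  have hXy : ∀ y, Tendsto (fun p : Sph m × ℝ => X y p.2) U (𝓝 (X y t)) := by
    intro y
    have h1 : Tendsto (fun p : Sph m × ℝ => ((y, p.2) : Sph m × ℝ)) U
        (𝓝[univ ×ˢ timeInterval T] (y, t)) := by
      refine tendsto_nhdsWithin_iff.2 ⟨?_, hmem.mono fun p hp => ⟨mem_univ _, hp.2⟩⟩
      have hc : Continuous fun p : Sph m × ℝ => ((y, p.2) : Sph m × ℝ) := by fun_prop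
      exact (hc.tendsto (x, t)).mono_left (hU.trans nhdsWithin_le_nhds)
    exact (hX (y, t) ⟨mem_univ _, ht⟩).tendsto.comp h1
  have hzpos : δ ≤ ⟪X x t, (z : Euc m)⟫ :=
    ge_of_tendsto (hXU.inner hUz') (hmem.mono fun p hp => hpos p.2 hp.2 p.1)
  refine hh.eq_normal x z (diffAt_eq_zero_of_isLocalMax (hh.mdifferentiableAt x) fun y => ?_)
    (hδ.trans_le hzpos) (hδ.trans_le (hpos t ht x))
  exact le_of_tendsto (((hXy y).sub hXU).inner hUz')
    (hmem.mono fun p hp => (hF.convex p.2 hp.2).outer p.1 y)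

theorem continuousOn_velocity : ContinuousOn
    (fun p : Sph m × ℝ => derivWithin (fun s => X p.1 s) (timeInterval T) p.2)
    (univ ×ˢ timeInterval T) := by
  rintro ⟨x₀, t⟩ ⟨-, ht⟩
  have huniq := uniqueDiffOn_timeInterval ht
  set S : Set (EuclideanSpace ℝ (Fin m) × ℝ) := univ ×ˢ timeInterval T
  have hS : UniqueDiffOn ℝ S := uniqueDiffOn_univ.prod huniq
  have hsm := hF.contDiffOn_flowParam x₀
  have hV : ContinuousOn (fun q => fderivWithin ℝ (flowParam X x₀) S q (0, 1)) S :=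
    (hsm.continuousOn_fderivWithin hS (by simp)).clm_apply continuousOn_const
  have hVeq : ∀ u, ∀ s ∈ timeInterval T, derivWithin (fun r => X (sphParam x₀ u) r)
      (timeInterval T) s = fderivWithin ℝ (flowParam X x₀) S (u, s) (0, 1) := by
    intro u s hs
    have h1 := ((hsm (u, s) ⟨mem_univ _, hs⟩).differentiableWithinAt (by simp)).hasFDerivWithinAt
    have h2 : HasDerivWithinAt (fun r : ℝ => (u, r)) (0, 1) (timeInterval T) s :=
      (hasDerivWithinAt_const _ _ _).prodMk (hasDerivWithinAt_id _ _)
    exact (h1.comp_hasDerivWithinAt s h2 fun r hr => ⟨mem_univ _, hr⟩).derivWithin (huniq s hs)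
  set φ := extChartAt (𝓡 m) x₀
  have hφ : ContinuousAt φ x₀ := continuousAt_extChartAt x₀
  have hpair : ContinuousWithinAt (fun p : Sph m × ℝ => (φ p.1, p.2)) (univ ×ˢ timeInterval T)
      (x₀, t) := by
    refine ContinuousAt.continuousWithinAt ?_
    exact (ContinuousAt.comp (f := Prod.fst) hφ continuousAt_fst).prodMk continuousAt_snd
  have h3 : ContinuousWithinAt (fun p : Sph m × ℝ =>
      fderivWithin ℝ (flowParam X x₀) S (φ p.1, p.2) (0, 1)) (univ ×ˢ timeInterval T) (x₀, t) :=
    ContinuousWithinAt.comp (t := S) (g := fun q => fderivWithin ℝ (flowParam X x₀) S q (0, 1))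
      (hV _ ⟨mem_univ _, ht⟩) hpair fun p hp => ⟨mem_univ _, hp.2⟩
  have hev : ∀ᶠ p : Sph m × ℝ in 𝓝[univ ×ˢ timeInterval T] (x₀, t),
      derivWithin (fun s => X p.1 s) (timeInterval T) p.2 =
        fderivWithin ℝ (flowParam X x₀) S (φ p.1, p.2) (0, 1) := by
    have h4 : ∀ᶠ p : Sph m × ℝ in 𝓝 (x₀, t), sphParam x₀ (φ p.1) = p.1 :=
      (continuous_fst.tendsto (x₀, t)).eventually (sphParam_extChartAt_eventually x₀)
    filter_upwards [h4.filter_mono nhdsWithin_le_nhds, self_mem_nhdsWithin] with p hp hpS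
    rw [← hVeq _ _ hpS.2, hp]
  exact h3.congr_of_eventuallyEq hev (hev.self_of_nhdsWithin ⟨mem_univ _, ht⟩)

/-- Expresses the speed through `X`, its velocity and `ν`, which are jointly continuous; continuity
of the curvature in space and time need not be shown separately. -/
theorem normalSpeed_eq {t : ℝ} (ht : t ∈ timeInterval T) (x : Sph m) :
    normalSpeed f g X ν x t =
      ⟪X x t - derivWithin (fun s => X x s) (timeInterval T) t, (ν x t : Euc m)⟫ := by
  rw [(hF.flow x t ht).derivWithin (uniqueDiffOn_timeInterval ht t ht), sub_add_cancel_right,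
    neg_smul, neg_neg, real_inner_smul_left, real_inner_self_eq_norm_sq, norm_eq_of_mem_sphere]
  simp [normalSpeed]

end IsConvexFlow

/-! ### The curvature bound -/

theorem lemma4p2 (m : ℕ) (hm : 1 ≤ m) (c a A L K₀ : ℝ) (hc : 0 < c) (ha : 0 < a) :
    ∃ C : ℝ, 0 < C ∧
      ∀ (f g : Sph m → ℝ) (T : EReal) (X : Sph m → ℝ → Euc m) (ν : Sph m → ℝ → Sph m),
        ContMDiff (𝓡 m) 𝓘(ℝ, ℝ) ∞ f →
        ContMDiff (𝓡 m) 𝓘(ℝ, ℝ) ∞ g →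
        (∀ x, a ≤ f x ∧ f x ≤ A) →
        (∀ x, a ≤ g x ∧ g x ≤ A) →
        GradBound g L →
        IsConvexFlow f g T X ν →
        (∀ x, gaussCurvature (fun y => X y 0) (fun y => ν y 0) x ≤ K₀) →
        (∀ t ∈ timeInterval T, ∀ x : Sph m,
          c⁻¹ ≤ supportFn (range fun y => X y t) x ∧ supportFn (range fun y => X y t) x ≤ c) →
        ∀ t ∈ timeInterval T, ∀ x : Sph m,
          gaussCurvature (fun y => X y t) (fun y => ν y t) x ≤ C := by
  set ε : ℝ := c⁻¹ / 2 with hεdef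
  have hε : 0 < ε := by positivity
  -- Bounds the curvature at a maximum of `Q` above `1`, whether at time `0` or later.
  set κ : ℝ := max K₀ (((m + 1 + 4 * ε + (m + 1 + 2 * |L| / a) * (5 / 2)) / ε) ^ (m + 1)) with hκ
  have hκ0 : 0 < κ := lt_max_of_lt_right (by positivity)
  -- The constants precede `f` and `g`, so `A` is not yet known to be positive.
  set A₁ : ℝ := max A a with hA₁
  have hA₁0 : 0 < A₁ := lt_max_of_lt_right ha
  set M₁ : ℝ := max 1 (A₁ / a * c ^ (m + 1) * κ / ε) with hM₁
  have hM₁0 : 0 < M₁ := lt_max_of_lt_left one_pos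
  set r : ℝ := a / A₁ * (c⁻¹) ^ (m + 1) with hr
  have hr0 : 0 < r := by positivity
  refine ⟨M₁ * c / r, by positivity, ?_⟩
  intro f g T X ν _ hg hfb hgb hL hF hK₀ hsupp t₁ ht₁ x₁
  have hlow : ∀ t ∈ timeInterval T, ∀ x, 2 * ε ≤ ⟪X x t, (ν x t : Euc m)⟫ := by
    intro t ht x
    rw [← (hF.convex t ht).supportFn_normal x, hεdef, mul_div_cancel₀ _ two_ne_zero]
    exact (hsupp t ht _).1
  have hup : ∀ t ∈ timeInterval T, ∀ x, ⟪X x t, (ν x t : Euc m)⟫ ≤ c := by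
    intro t ht x
    rw [← (hF.convex t ht).supportFn_normal x]
    exact (hsupp t ht _).2
  have hXlow : ∀ t ∈ timeInterval T, ∀ x, c⁻¹ ≤ ‖X x t‖ := by
    intro t ht x
    have h1 := (hlow t ht x).trans (real_inner_le_norm _ _)
    rw [norm_eq_of_mem_sphere, mul_one, hεdef, mul_div_cancel₀ _ two_ne_zero] at h1
    exact h1
  have hXup : ∀ t ∈ timeInterval T, ∀ x, ‖X x t‖ ≤ c := by
    intro t ht x
    have h0 : X x t ≠ 0 := norm_pos_iff.1 ((inv_pos.2 hc).trans_le (hXlow t ht x))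
    -- Testing the support function in the direction of `X` itself bounds `|X|`.
    have h1 := ((hF.convex t ht).inner_le_supportFn x (direction (X x t))).trans (hsupp t ht _).2
    rwa [coe_direction h0, real_inner_smul_right, real_inner_self_eq_norm_sq, sq, ← mul_assoc,
      inv_mul_cancel₀ (norm_ne_zero_iff.2 h0), one_mul] at h1
  have hfac : ∀ t ∈ timeInterval T, ∀ x, r ≤ f (ν x t) / g (direction (X x t)) * ‖X x t‖ ^ (m + 1) ∧
      f (ν x t) / g (direction (X x t)) * ‖X x t‖ ^ (m + 1) ≤ A₁ / a * c ^ (m + 1) := by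
    intro t ht x
    have hg0 : 0 < g (direction (X x t)) := ha.trans_le (hgb _).1
    have hf0 : 0 < f (ν x t) := ha.trans_le (hfb _).1
    have h1 := hXlow t ht x
    have h2 := hXup t ht x
    constructor
    · rw [hr]
      gcongr
      · exact (hfb _).1
      · exact (hgb _).2.trans (le_max_left _ _)
    · gcongr
      · exact (hfb _).2.trans (le_max_left _ _)
      · exact (hgb _).1
  set Q : Sph m × ℝ → ℝ := fun p =>
    normalSpeed f g X ν p.1 p.2 / (⟪X p.1 p.2, (ν p.1 p.2 : Euc m)⟫ - ε) with hQ
  have hsub : Icc 0 t₁ ⊆ timeInterval T := fun s hs =>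
    ⟨hs.1, (EReal.coe_le_coe_iff.2 hs.2).trans_lt ht₁.2⟩
  have hden : ∀ t ∈ timeInterval T, ∀ x, ε ≤ ⟪X x t, (ν x t : Euc m)⟫ - ε := fun t ht x => by
    linarith [hlow t ht x]
  have hcontν := hF.continuousOn_normal ⟨2 * ε, by positivity, hlow⟩
  have hcontν' : ContinuousOn (fun p : Sph m × ℝ => (ν p.1 p.2 : Euc m))
      (univ ×ˢ timeInterval T) := continuous_subtype_val.comp_continuousOn hcontν
  have hcontX := hF.smooth.continuousOn
  have hQcont : ContinuousOn Q (univ ×ˢ timeInterval T) := by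
    refine ContinuousOn.div ?_ ((hcontX.inner hcontν').sub continuousOn_const) fun p hp =>
      (hε.trans_le (hden p.2 hp.2 p.1)).ne'
    exact ((hcontX.sub hF.continuousOn_velocity).inner hcontν').congr fun p hp =>
      hF.normalSpeed_eq hp.2 p.1
  have hcompact : IsCompact ((univ : Set (Sph m)) ×ˢ Icc (0 : ℝ) t₁) :=
    isCompact_univ.prod isCompact_Icc
  obtain ⟨⟨x₀, t₀⟩, ⟨-, ht₀⟩, hmaxQ⟩ := hcompact.exists_isMaxOn
    ⟨(x₁, t₁), mem_univ _, ht₁.1, le_rfl⟩ (hQcont.mono (prod_mono_right hsub))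
  replace ht₀ : t₀ ∈ Icc 0 t₁ := ht₀
  have hQeq : ∀ t ∈ timeInterval T, ∀ x, normalSpeed f g X ν x t =
      Q (x, t) * (⟪X x t, (ν x t : Euc m)⟫ - ε) := fun t ht x =>
    (div_mul_cancel₀ _ (hε.trans_le (hden t ht x)).ne').symm
  have hQle : Q (x₀, t₀) ≤ M₁ := by
    by_contra! hlt
    have hM1 : 1 ≤ Q (x₀, t₀) := (le_max_left _ _).trans hlt.le
    have ht₀T := hsub ht₀
    have hcurv : gaussCurvature (fun y => X y t₀) (fun y => ν y t₀) x₀ ≤ κ := by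
      rcases ht₀.1.eq_or_lt with h0 | h0
      · rw [← h0]
        exact (hK₀ x₀).trans (le_max_left _ _)
      · refine (hF.gaussCurvature_le_of_max hm hg hL ha (fun x => (hfb x).1) (fun x => (hgb x).1) hε
          hM1 hlow (timeInterval_mem_nhds ht₀T h0) (fun t ht htle x => ?_)
          (hQeq t₀ ht₀T x₀)).trans (le_max_right _ _)
        rw [hQeq t ht x]
        exact mul_le_mul_of_nonneg_right (hmaxQ ⟨mem_univ x, ht.1, htle.trans ht₀.2⟩)
          (hε.le.trans (hden t ht x))
    refine hlt.not_ge ((?_ : Q (x₀, t₀) ≤ A₁ / a * c ^ (m + 1) * κ / ε).trans (le_max_right _ _))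
    have h1 : normalSpeed f g X ν x₀ t₀ ≤ A₁ / a * c ^ (m + 1) * κ := by
      refine (mul_le_mul_of_nonneg_left hcurv (hr0.le.trans (hfac t₀ ht₀T x₀).1)).trans ?_
      exact mul_le_mul_of_nonneg_right (hfac t₀ ht₀T x₀).2 hκ0.le
    exact div_le_div₀ (by positivity) h1 hε (hden t₀ ht₀T x₀)
  have hspeed : normalSpeed f g X ν x₁ t₁ ≤ M₁ * c := by
    rw [hQeq t₁ ht₁ x₁]
    refine mul_le_mul ((hmaxQ ⟨mem_univ x₁, ht₁.1, le_rfl⟩).trans hQle) ?_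
      (hε.le.trans (hden t₁ ht₁ x₁)) hM₁0.le
    linarith [hup t₁ ht₁ x₁]
  -- A nonpositive curvature satisfies the bound trivially; otherwise the lower bound `r` on the
  -- factor in front of it can be used.
  by_cases hK : gaussCurvature (fun y => X y t₁) (fun y => ν y t₁) x₁ ≤ 0
  · exact hK.trans (by positivity)
  · rw [le_div_iff₀ hr0, mul_comm]
    exact (mul_le_mul_of_nonneg_right (hfac t₁ ht₁ x₁).1 (not_le.1 hK).le).trans hspeed
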